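/- Let $K$ be a commutative ring with identity and let $q\in K$ be invertible. For $n\ge 1$ let $W(\tilde A_n)$ be the affine Coxeter group of type $\tilde A_n$ with Coxeter generators $S_n=\{\sigma_1,\dots,\sigma_n,a_{n+1}\}$: for $n\ge 2$ its Coxeter graph is the cycle $\sigma_1,\sigma_2,\dots,\sigma_n,a_{n+1}$ on $n+1$ vertices (all edges unlabelled), and $W(\tilde A_1)$ is the infinite dihedral group generated by $\sigma_1,a_2$. Let $\ell$ be the length function. The Hecke algebra $H\tilde A_n(q)$ is the free $K$-module with basis $\{g_w : w\in W(\tilde A_n)\}$ equipped with the unique unital associative $K$-algebra structure such that, for $s\in S_n$ and $w\in W(\tilde A_n)$, $$g_s g_w=g_{sw}\ \text{ if } \ell(sw)>\ell(w),\qquad g_s g_w=q\,g_{sw}+(q-1)\,g_w\ \text{ if } \ell(sw)<\ell(w);$$ each $g_s$, $s\in S_n$, is then invertible. Write $e_w$ for the basis elements of $H\tilde A_{n-1}(q)$ and $g_w$ for those of $H\tilde A_n(q)$. Then for every $n\ge 2$ there is a unique morphism of $K$-algebras $HR_n: H\tilde A_{n-1}(q)\to H\tilde A_n(q)$ such that $$HR_n(e_{\sigma_i})=g_{\sigma_i}\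 \ (1\le i\le n-1),\qquad HR_n(e_{a_n})=g_{\sigma_n}\,g_{a_{n+1}}\,g_{\sigma_n}^{-1},$$ and $HR_n$ is injective. That is, every arrow of the tower of affine Hecke algebras $$H\tilde A_1(q)\xrightarrow{HR_2}H\tilde A_2(q)\xrightarrow{HR_3}\cdots\to H\tilde A_{n-1}(q)\xrightarrow{HR_n}H\tilde A_n(q)\to\cdots$$ is injective. -/

import Mathlib

noncomputable section

/-! ### The exchange property of Coxeter systems -/

namespace CoxeterSystem

variable {B W : Type*} [Group W] {M : CoxeterMatrix B} (cs : CoxeterSystem M W)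

open Classical in
/-- The map `(t, ε) ↦ (s t s, ε + [t = s])` on `W × ℤ/2`, where `s = s_i`. -/
def reflFlip (i : B) : Function.End (W × ZMod 2) := fun p =>
  (cs.simple i * p.1 * cs.simple i, p.2 + if p.1 = cs.simple i then 1 else 0)

open Classical in
theorem reflFlip_pow (i j : B) (k : ℕ) (t : W) (e : ZMod 2) :
    ((cs.reflFlip i * cs.reflFlip j) ^ k) (t, e) =
      ((cs.simple i * cs.simple j) ^ k * t * ((cs.simple i * cs.simple j) ^ k)⁻¹,
        e + ∑ p ∈ Finset.range (2 * k),
          if t = cs.simple j * (cs.simple i * cs.simple j) ^ p then 1 else 0) := by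
  obtain ⟨c, hc⟩ : ∃ c, c = cs.simple i * cs.simple j := ⟨_, rfl⟩
  simp only [← hc]
  have hjc : ∀ p : ℕ, (c ^ p)⁻¹ * cs.simple j = cs.simple j * c ^ p := by
    intro p
    have h1 : c⁻¹ = cs.simple j * c * (cs.simple j)⁻¹ := by simp [hc, mul_assoc]
    rw [← inv_pow, h1, conj_pow]
    simp [mul_assoc]
  induction k with
  | zero => simp; rfl
  | succ k ih =>
    rw [pow_succ']
    change cs.reflFlip i (cs.reflFlip j (((cs.reflFlip i * cs.reflFlip j) ^ k) (t, e))) = _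
    rw [ih]
    have e1 : c ^ k * t * (c ^ k)⁻¹ = cs.simple j ↔ t = cs.simple j * c ^ (2 * k) := by
      rw [two_mul, pow_add, ← mul_assoc, ← hjc]
      constructor
      · intro h; rw [← h]; group
      · intro h; rw [h]; group
    have e2 : cs.simple j * (c ^ k * t * (c ^ k)⁻¹) * cs.simple j = cs.simple i ↔
        t = cs.simple j * c ^ (2 * k + 1) := by
      have h3 : cs.simple j * c ^ (2 * k + 1) =
          (c ^ k)⁻¹ * (cs.simple j * cs.simple i * cs.simple j) * c ^ k := by
        have h4 : cs.simple j * cs.simple i * cs.simple j = cs.simple j * c := by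
          simp [hc, mul_assoc]
        have h5 : c ^ (2 * k + 1) = c ^ k * c * c ^ k := by
          rw [← pow_succ, ← pow_add]; congr 1; ring
        rw [h4, ← mul_assoc, hjc, h5]
        simp only [mul_assoc]
      rw [h3]
      constructor
      · intro h; rw [← h]; simp [mul_assoc]
      · intro h; rw [h]; simp [mul_assoc]
    rw [show 2 * (k + 1) = 2 * k + 1 + 1 by ring, Finset.sum_range_succ, Finset.sum_range_succ]
    simp only [reflFlip, e1, e2]
    refine Prod.ext ?_ ?_
    · have h7 : ∀ x, c * x = cs.simple i * (cs.simple j * x) := fun x => by rw [hc, mul_assoc]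
      dsimp only
      simp only [pow_succ' c k, mul_inv_rev, inv_simple, mul_assoc, h7]
    · simp only [add_assoc]

theorem reflFlip_isLiftable : M.IsLiftable cs.reflFlip := by
  classical
  intro i j
  funext ⟨t, e⟩
  rw [cs.reflFlip_pow, cs.simple_mul_simple_pow, two_mul, Finset.sum_range_add]
  have : ∀ p, (cs.simple i * cs.simple j) ^ (M i j + p) = (cs.simple i * cs.simple j) ^ p := by
    intro p; rw [pow_add, cs.simple_mul_simple_pow, one_mul]
  simp only [this, CharTwo.add_self_eq_zero]
  simp [Function.End.one_def]

open Classical in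
theorem reflFlip_wordProd (ω : List B) (t : W) (e : ZMod 2) :
    cs.lift ⟨cs.reflFlip, cs.reflFlip_isLiftable⟩ (cs.wordProd ω) (t, e) =
      (cs.wordProd ω * t * (cs.wordProd ω)⁻¹, e + ((cs.rightInvSeq ω).count t : ZMod 2)) := by
  induction ω with
  | nil => simp [Function.End.one_def]
  | cons i ω ih =>
    rw [wordProd_cons, map_mul, lift_apply_simple]
    change cs.reflFlip i (cs.lift ⟨cs.reflFlip, cs.reflFlip_isLiftable⟩ (cs.wordProd ω) (t, e)) = _
    rw [ih]
    have h : cs.wordProd ω * t * (cs.wordProd ω)⁻¹ = cs.simple i ↔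
        (cs.wordProd ω)⁻¹ * cs.simple i * cs.wordProd ω = t := by
      constructor
      · intro h; rw [← h]; group
      · intro h; rw [← h]; group
    simp only [reflFlip, rightInvSeq, List.count_cons, h, beq_iff_eq]
    refine Prod.ext ?_ ?_
    · simp [mul_assoc]
    · push_cast; simp only [add_assoc]

/-- Exchange: a right descent of `π ω` occurs in the right inversion sequence of `ω`. -/
theorem simple_mem_rightInvSeq {ω : List B} {i : B}
    (h : cs.IsRightDescent (cs.wordProd ω) i) : cs.simple i ∈ cs.rightInvSeq ω := by
  classical
  obtain ⟨ω', hω', hw⟩ := cs.exists_isReduced (cs.wordProd ω * cs.simple i)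
  have hprod : cs.wordProd (ω' ++ [i]) = cs.wordProd ω := by
    rw [wordProd_append, ← hw]; simp
  have hred : cs.IsReduced (ω' ++ [i]) := by
    have h1 := cs.isRightDescent_iff.1 h
    have h2 : cs.length (cs.wordProd ω') = ω'.length := hω'
    rw [IsReduced, hprod, ← h1, hw, h2]; simp
  have hmem : cs.simple i ∈ cs.rightInvSeq (ω' ++ [i]) := by
    rw [← List.concat_eq_append, rightInvSeq_concat]; simp
  have hcount := List.count_eq_one_of_mem hred.nodup_rightInvSeq hmem
  have e1 := cs.reflFlip_wordProd ω (cs.simple i) 0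
  have e2 := cs.reflFlip_wordProd (ω' ++ [i]) (cs.simple i) 0
  rw [hprod, e1, hcount] at e2
  have e3 := congrArg Prod.snd e2
  simp only [zero_add, Nat.cast_one] at e3
  by_contra hn
  rw [List.count_eq_zero_of_not_mem hn] at e3
  simp at e3

theorem simple_mem_leftInvSeq {ω : List B} {i : B}
    (h : cs.IsLeftDescent (cs.wordProd ω) i) : cs.simple i ∈ cs.leftInvSeq ω := by
  have := cs.simple_mem_rightInvSeq (ω := ω.reverse) (i := i)
    (by rw [wordProd_reverse, isRightDescent_inv_iff]; exact h)
  rw [rightInvSeq_reverse] at this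
  simpa using this

theorem simple_mul_eq_mul_simple {w : W} {i j : B} (h : ¬ cs.IsLeftDescent w i)
    (h' : cs.IsLeftDescent (w * cs.simple j) i) : cs.simple i * w = w * cs.simple j := by
  obtain ⟨ω, hω, rfl⟩ := cs.exists_isReduced w
  have hp : cs.wordProd (ω ++ [j]) = cs.wordProd ω * cs.simple j := by
    rw [wordProd_append]; simp
  rw [← hp] at h'
  have hm := cs.simple_mem_leftInvSeq h'
  rw [← List.concat_eq_append, leftInvSeq_concat, List.concat_eq_append, List.mem_append,
    List.mem_singleton] at hm
  rcases hm with hm | hm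
  · exact absurd (cs.isLeftInversion_of_mem_leftInvSeq hω hm).2 h
  · rw [hm]; simp

theorem isLeftDescent_mul_simple_iff {w : W} {i j : B}
    (h : cs.simple i * w ≠ w * cs.simple j) :
    cs.IsLeftDescent (w * cs.simple j) i ↔ cs.IsLeftDescent w i := by
  constructor
  · intro h1
    by_contra h2
    exact h (cs.simple_mul_eq_mul_simple h2 h1)
  · intro h1
    by_contra h2
    have := cs.simple_mul_eq_mul_simple (j := j) h2 (by simpa using h1)
    apply h
    rw [← mul_assoc] at this
    simp only [simple_mul_simple_cancel_right] at this
    rw [← cs.simple_mul_simple_cancel_right (w := cs.simple i * w) j, this]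

theorem isRightDescent_simple_mul_iff {w : W} {i j : B}
    (h : cs.simple i * w ≠ w * cs.simple j) :
    cs.IsRightDescent (cs.simple i * w) j ↔ cs.IsRightDescent w j := by
  rw [← isLeftDescent_inv_iff, ← isLeftDescent_inv_iff, mul_inv_rev, inv_simple]
  apply isLeftDescent_mul_simple_iff
  intro h'
  apply h
  have := congrArg (·⁻¹) h'
  simpa using this.symm

end CoxeterSystem

/-! ### Hecke algebras of Coxeter systems -/

namespace Hecke

variable {B W K : Type*} [Group W] [CommRing K] {M : CoxeterMatrix B}
  (cs : CoxeterSystem M W) (q : K)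

open Classical in
/-- The operator `g_w ↦ g_{sw}` if `s ∉ L(w)`, `g_w ↦ q g_{sw} + (q - 1) g_w` if `s ∈ L(w)`. -/
def leftOp (i : B) : Module.End K (W →₀ K) :=
  Finsupp.linearCombination K fun w =>
    if cs.IsLeftDescent w i then
      q • Finsupp.single (cs.simple i * w) 1 + (q - 1) • Finsupp.single w 1
    else Finsupp.single (cs.simple i * w) 1

open Classical in
/-- The mirror image of `leftOp`. -/
def rightOp (i : B) : Module.End K (W →₀ K) :=
  Finsupp.linearCombination K fun w =>
    if cs.IsRightDescent w i then
      q • Finsupp.single (w * cs.simple i) 1 + (q - 1) • Finsupp.single w 1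
    else Finsupp.single (w * cs.simple i) 1

open Classical in
theorem leftOp_single (i : B) (w : W) : leftOp cs q i (Finsupp.single w 1) =
    if cs.IsLeftDescent w i then
      q • Finsupp.single (cs.simple i * w) 1 + (q - 1) • Finsupp.single w 1
    else Finsupp.single (cs.simple i * w) 1 := by
  simp only [leftOp, Finsupp.linearCombination_single, one_smul]

open Classical in
theorem rightOp_single (i : B) (w : W) : rightOp cs q i (Finsupp.single w 1) =
    if cs.IsRightDescent w i then
      q • Finsupp.single (w * cs.simple i) 1 + (q - 1) • Finsupp.single w 1
    else Finsupp.single (w * cs.simple i) 1 := by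
  simp only [rightOp, Finsupp.linearCombination_single, one_smul]

theorem leftOp_comm_rightOp (i j : B) : Commute (leftOp cs q i) (rightOp cs q j) := by
  classical
  refine Finsupp.lhom_ext' fun w => LinearMap.ext_ring ?_
  simp only [LinearMap.comp_apply, Finsupp.lsingle_apply, Module.End.mul_apply]
  rw [leftOp_single, rightOp_single]
  by_cases h : cs.simple i * w = w * cs.simple j
  · have hPQ : cs.IsLeftDescent w i ↔ cs.IsRightDescent w j := by
      rw [CoxeterSystem.IsLeftDescent, CoxeterSystem.IsRightDescent, h]
    have hP' : cs.IsLeftDescent (w * cs.simple j) i ↔ ¬ cs.IsLeftDescent w i := by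
      rw [← h, cs.isLeftDescent_iff_not_isLeftDescent_mul]; simp
    have hQ' : cs.IsRightDescent (cs.simple i * w) j ↔ ¬ cs.IsRightDescent w j := by
      rw [h, cs.isRightDescent_iff_not_isRightDescent_mul]; simp
    have hw : cs.simple i * w * cs.simple j = w := by rw [h]; simp
    have hw' : cs.simple i * (w * cs.simple j) = w := by rw [← mul_assoc, hw]
    by_cases hQ : cs.IsRightDescent w j
    · have hP := hPQ.2 hQ
      rw [if_pos hP, if_pos hQ]
      simp only [map_add, map_smul, leftOp_single, rightOp_single, hP, hQ, hP', hQ', not_true,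
        if_true, if_false, hw, hw']
      rw [h]
    · have hP : ¬ cs.IsLeftDescent w i := fun hP => hQ (hPQ.1 hP)
      rw [if_neg hP, if_neg hQ]
      simp only [leftOp_single, rightOp_single, hP, hQ, hP', hQ', not_false_eq_true,
        if_true, hw, hw']
      rw [h]
  · have hP' := cs.isLeftDescent_mul_simple_iff h
    have hQ' := cs.isRightDescent_simple_mul_iff h
    by_cases hP : cs.IsLeftDescent w i <;> by_cases hQ : cs.IsRightDescent w j <;>
      simp only [hP, hQ, hP', hQ', if_true, if_false, map_add, map_smul, leftOp_single,
        rightOp_single, mul_assoc]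
    all_goals module

/-- The algebra of operators generated by the `leftOp`s. -/
def opAlg : Subalgebra K (Module.End K (W →₀ K)) :=
  Algebra.adjoin K (Set.range (leftOp cs q))

theorem opAlg_comm_rightOp {φ : Module.End K (W →₀ K)} (hφ : φ ∈ opAlg cs q) (j : B) :
    Commute φ (rightOp cs q j) := by
  induction hφ using Algebra.adjoin_induction with
  | mem x hx => obtain ⟨i, rfl⟩ := hx; exact leftOp_comm_rightOp cs q i j
  | algebraMap r => exact Algebra.commutes r _
  | add x y _ _ hx hy => exact hx.add_left hy
  | mul x y _ _ hx hy => exact hx.mul_left hy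

theorem opAlg_ext {φ ψ : Module.End K (W →₀ K)} (hφ : φ ∈ opAlg cs q) (hψ : ψ ∈ opAlg cs q)
    (h : φ (Finsupp.single 1 1) = ψ (Finsupp.single 1 1)) : φ = ψ := by
  classical
  refine Finsupp.lhom_ext' fun w => LinearMap.ext_ring ?_
  simp only [LinearMap.comp_apply, Finsupp.lsingle_apply]
  induction hn : cs.length w generalizing w with
  | zero => rw [cs.length_eq_zero_iff.1 hn]; exact h
  | succ n ih =>
    obtain ⟨j, hj⟩ := cs.exists_rightDescent_of_ne_one
      (w := w) (by rintro rfl; simp at hn)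
    have hj' := (cs.isRightDescent_iff_not_isRightDescent_mul).1 hj
    have hl := cs.isRightDescent_iff.1 hj
    have e : Finsupp.single w 1 = rightOp cs q j (Finsupp.single (w * cs.simple j) 1) := by
      rw [rightOp_single, if_neg hj']; simp
    have c : ∀ χ ∈ opAlg cs q, ∀ x, χ (rightOp cs q j x) = rightOp cs q j (χ x) :=
      fun χ hχ x => LinearMap.congr_fun (opAlg_comm_rightOp cs q hχ j).eq x
    rw [e, c φ hφ, c ψ hψ, ih _ (by omega)]

/-- Evaluation of operators at `g_1`. -/
def evalOne : opAlg cs q →ₗ[K] (W →₀ K) :=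
  (LinearMap.applyₗ (Finsupp.single (1 : W) (1 : K))).comp (opAlg cs q).val.toLinearMap

theorem evalOne_apply (φ : opAlg cs q) :
    evalOne cs q φ = (φ : Module.End K (W →₀ K)) (Finsupp.single 1 1) := rfl

theorem evalOne_bijective : Function.Bijective (evalOne cs q) := by
  classical
  constructor
  · intro φ ψ h
    exact Subtype.ext (opAlg_ext cs q φ.2 ψ.2 h)
  · have key : ∀ w : W, ∃ φ, evalOne cs q φ = Finsupp.single w 1 := by
      intro w
      induction hn : cs.length w generalizing w with
      | zero => exact ⟨1, by rw [cs.length_eq_zero_iff.1 hn]; rfl⟩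
      | succ n ih =>
        obtain ⟨j, hj⟩ := cs.exists_leftDescent_of_ne_one
          (w := w) (by rintro rfl; simp at hn)
        have hj' := (cs.isLeftDescent_iff_not_isLeftDescent_mul).1 hj
        have hl := cs.isLeftDescent_iff.1 hj
        obtain ⟨φ, hφ⟩ := ih (cs.simple j * w) (by omega)
        refine ⟨⟨leftOp cs q j, Algebra.subset_adjoin ⟨j, rfl⟩⟩ * φ, ?_⟩
        rw [evalOne_apply] at hφ ⊢
        change leftOp cs q j ((φ : Module.End K (W →₀ K)) (Finsupp.single 1 1)) = _
        rw [hφ, leftOp_single, if_neg hj']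
        simp
    intro x
    induction x using Finsupp.induction_linear with
    | zero => exact ⟨0, map_zero _⟩
    | add x y hx hy =>
      obtain ⟨φ, rfl⟩ := hx
      obtain ⟨ψ, rfl⟩ := hy
      exact ⟨φ + ψ, map_add _ _ _⟩
    | single w a =>
      obtain ⟨φ, hφ⟩ := key w
      exact ⟨a • φ, by rw [map_smul, hφ]; simp⟩

/-- The operator in `opAlg` that sends `g_1` to `x`: left multiplication by `x`. -/
def mulOp : (W →₀ K) →ₗ[K] Module.End K (W →₀ K) :=
  (opAlg cs q).val.toLinearMap.comp
    (LinearEquiv.ofBijective (evalOne cs q) (evalOne_bijective cs q)).symm.toLinearMap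

theorem mulOp_mem (x : W →₀ K) : mulOp cs q x ∈ opAlg cs q :=
  ((LinearEquiv.ofBijective (evalOne cs q) (evalOne_bijective cs q)).symm x).2

theorem mulOp_one_right (x : W →₀ K) : mulOp cs q x (Finsupp.single 1 1) = x :=
  (LinearEquiv.ofBijective (evalOne cs q) (evalOne_bijective cs q)).apply_symm_apply x

theorem mulOp_one_left : mulOp cs q (Finsupp.single 1 1) = 1 :=
  opAlg_ext cs q (mulOp_mem cs q _) (one_mem _) (mulOp_one_right cs q _)

theorem mulOp_mulOp (x y : W →₀ K) : mulOp cs q (mulOp cs q x y) = mulOp cs q x * mulOp cs q y :=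
  opAlg_ext cs q (mulOp_mem cs q _) (mul_mem (mulOp_mem cs q _) (mulOp_mem cs q _))
    (by rw [mulOp_one_right, Module.End.mul_apply, mulOp_one_right])

theorem mulOp_simple (i : B) : mulOp cs q (Finsupp.single (cs.simple i) 1) = leftOp cs q i :=
  opAlg_ext cs q (mulOp_mem cs q _) (Algebra.subset_adjoin ⟨i, rfl⟩)
    (by rw [mulOp_one_right, leftOp_single, if_neg (cs.not_isLeftDescent_one i), mul_one])

end Hecke

/-- The Hecke algebra with parameter `q` of a Coxeter system: the free `K`-module with basis
`g_w`, `w ∈ W`, with the unique algebra structure such that, for every simple reflection `s`,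
`g_s g_w = g_{sw}` if `ℓ(sw) > ℓ(w)` and `g_s g_w = q g_{sw} + (q - 1) g_w` if `ℓ(sw) < ℓ(w)`
(see `HeckeAlgebra.g_simple_mul_g_of_not_isLeftDescent` and
`HeckeAlgebra.g_simple_mul_g_of_isLeftDescent`). -/
@[nolint unusedArguments]
def HeckeAlgebra {B W K : Type*} [Group W] [CommRing K] {M : CoxeterMatrix B}
    (_cs : CoxeterSystem M W) (_q : K) : Type _ := W →₀ K

namespace HeckeAlgebra

variable {B W K : Type*} [Group W] [CommRing K] {M : CoxeterMatrix B}
  (cs : CoxeterSystem M W) (q : K)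

instance : AddCommGroup (HeckeAlgebra cs q) := inferInstanceAs (AddCommGroup (W →₀ K))

instance : Module K (HeckeAlgebra cs q) := inferInstanceAs (Module K (W →₀ K))

/-- The multiplication as a linear map. -/
def mulLeft : HeckeAlgebra cs q →ₗ[K] Module.End K (HeckeAlgebra cs q) := Hecke.mulOp cs q

instance : Ring (HeckeAlgebra cs q) :=
  { (inferInstance : AddCommGroup (HeckeAlgebra cs q)) with
    mul := fun x y => mulLeft cs q x y
    one := (Finsupp.single 1 1 : W →₀ K)
    mul_assoc := fun x y z => LinearMap.congr_fun (Hecke.mulOp_mulOp cs q x y) z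
    one_mul := fun x => LinearMap.congr_fun (Hecke.mulOp_one_left cs q) x
    mul_one := fun x => Hecke.mulOp_one_right cs q x
    left_distrib := fun x y z => map_add (mulLeft cs q x) y z
    right_distrib := fun x y z => LinearMap.congr_fun (map_add (mulLeft cs q) x y) z
    zero_mul := fun x => LinearMap.congr_fun (map_zero (mulLeft cs q)) x
    mul_zero := fun x => map_zero (mulLeft cs q x) }

instance : Algebra K (HeckeAlgebra cs q) :=
  Algebra.ofModule
    (fun r x y => LinearMap.congr_fun (map_smul (mulLeft cs q) r x) y)
    (fun r x y => map_smul (mulLeft cs q x) r y)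

/-- The basis `(g_w)` of the Hecke algebra, indexed by `w ∈ W`. -/
def g : Module.Basis W K (HeckeAlgebra cs q) := ⟨LinearEquiv.refl K (W →₀ K)⟩

theorem g_apply (w : W) : g cs q w = (Finsupp.single w 1 : W →₀ K) := rfl

theorem g_one : g cs q 1 = 1 := rfl

theorem g_simple_mul_g_of_not_isLeftDescent {w : W} {i : B} (h : ¬ cs.IsLeftDescent w i) :
    g cs q (cs.simple i) * g cs q w = g cs q (cs.simple i * w) := by
  change Hecke.mulOp cs q (Finsupp.single (cs.simple i) 1) (Finsupp.single w 1) = _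
  rw [Hecke.mulOp_simple, Hecke.leftOp_single, if_neg h]
  rfl

theorem g_simple_mul_g_of_isLeftDescent {w : W} {i : B} (h : cs.IsLeftDescent w i) :
    g cs q (cs.simple i) * g cs q w =
      q • g cs q (cs.simple i * w) + (q - 1) • g cs q w := by
  change Hecke.mulOp cs q (Finsupp.single (cs.simple i) 1) (Finsupp.single w 1) = _
  rw [Hecke.mulOp_simple, Hecke.leftOp_single, if_pos h]
  rfl

theorem g_simple_mul_self (i : B) :
    g cs q (cs.simple i) * g cs q (cs.simple i) =
      q • (1 : HeckeAlgebra cs q) + (q - 1) • g cs q (cs.simple i) := by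
  rw [g_simple_mul_g_of_isLeftDescent cs q (by simp [CoxeterSystem.IsLeftDescent]),
    cs.simple_mul_simple_self, g_one]

/-- For `q` invertible, `g_s` as a unit of the Hecke algebra. -/
def gUnit (q : Kˣ) (i : B) : (HeckeAlgebra cs (q : K))ˣ where
  val := g cs (q : K) (cs.simple i)
  inv := (↑q⁻¹ : K) • (g cs (q : K) (cs.simple i) - ((q : K) - 1) • 1)
  val_inv := by
    rw [mul_smul_comm, mul_sub, g_simple_mul_self, mul_smul_comm, mul_one, add_sub_cancel_right,
      smul_smul, Units.inv_mul, one_smul]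
  inv_val := by
    rw [smul_mul_assoc, sub_mul, g_simple_mul_self, smul_mul_assoc, one_mul, add_sub_cancel_right,
      smul_smul, Units.inv_mul, one_smul]

end HeckeAlgebra

/-! ### Affine type A -/

/-- The Coxeter matrix of type `Ã_n`, `n ≥ 1`. The index `i - 1` stands for `σ_i`, `1 ≤ i ≤ n`, and
the index `n` for `a_{n+1}`. For `n ≥ 2` the Coxeter graph is a cycle on `n + 1` vertices (the
addition in `Fin (n + 1)` is cyclic); for `n = 1` the product of the two generators has infinite
order, which is encoded by the entry `0`. -/
def CoxeterMatrix.affineA (n : ℕ) : CoxeterMatrix (Fin (n + 1)) where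
  M := Matrix.of fun i j =>
    if i = j then 1 else if n = 1 then 0 else if j = i + 1 ∨ i = j + 1 then 3 else 2
  isSymm := by
    ext i j
    simp only [Matrix.transpose_apply, Matrix.of_apply, eq_comm (a := j) (b := i),
      or_comm (a := i = j + 1)]
  diagonal := by simp
  off_diagonal := by
    intro i j h
    simp only [Matrix.of_apply, if_neg h]
    split_ifs <;> decide

/-- The Coxeter group `W(Ã_n)`. -/
abbrev AffineA.W (n : ℕ) : Type := (CoxeterMatrix.affineA n).Group

/-- The Coxeter system of type `Ã_n`. -/
abbrev AffineA.cs (n : ℕ) : CoxeterSystem (CoxeterMatrix.affineA n) (AffineA.W n) :=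
  (CoxeterMatrix.affineA n).toCoxeterSystem

/-- The Hecke algebra `HÃ_n(q)`. -/
abbrev AffineA.H {K : Type*} [CommRing K] (q : Kˣ) (n : ℕ) : Type _ :=
  HeckeAlgebra (AffineA.cs n) (q : K)

namespace AffineA

variable {K : Type*} [CommRing K] (q : Kˣ) (n : ℕ)

/-- The invertible generator `g_{σ_{i+1}}` of `HÃ_n(q)`, for `0 ≤ i < n`. -/
def gσ (i : Fin n) : (H q n)ˣ := HeckeAlgebra.gUnit (cs n) q i.castSucc

/-- The invertible generator `g_{a_{n+1}}` of `HÃ_n(q)`. -/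
def gA : (H q n)ˣ := HeckeAlgebra.gUnit (cs n) q (Fin.last n)

/-- The algebra morphism `φ : HÃ_n(q) → HÃ_{n+1}(q)` satisfies `φ(e_{σ_i}) = g_{σ_i}` for
`1 ≤ i ≤ n` and `φ(e_{a_{n+1}}) = g_{σ_{n+1}} g_{a_{n+2}} g_{σ_{n+1}}⁻¹`. -/
def IsHR (φ : H q n →ₐ[K] H q (n + 1)) : Prop :=
  (∀ i : Fin n, φ (gσ q n i) = gσ q (n + 1) i.castSucc) ∧
    φ (gA q n) = gσ q (n + 1) (Fin.last n) * gA q (n + 1) * ↑(gσ q (n + 1) (Fin.last n))⁻¹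

end AffineA

end

/-! The group `W n` acts faithfully on ℤ by permutations that commute with translation by `n + 1`,
and `s_i` is a right descent of `w` exactly when `w (x + 1) < w x` for the integers `x` of residue
`i`. This turns every length comparison below into an inequality between integers.

Existence of the morphism is the universal property of the Hecke algebra: a family satisfying the
braid and quadratic relations extends (`exists_lift`), because its product along a reduced word does
not depend on the word. Uniqueness holds because the `g_s` generate.

For injectivity, an affine permutation `w` of period `n + 1` is extended to one of period `n + 2`,
called `v`, by adding a fixed "special" strand in each period. On groups this sends `a_{n+1}` to
`σ_{n+1} a_{n+2} σ_{n+1}`, whereas the morphism has an inverse in the last factor. That inverse is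
harmless when the special strands take very large values: let `c` push the special strands up and
all other strands down. For `k` large, each of the three factors then multiplies `g_{c^k v}` with no
quadratic correction, so that `g_{c^k} φ(e_w) = g_{c^k v}` (`exists_image`).

Hence `φ(e_w) = g_{c^k}⁻¹ g_{c^k v}`, which is a unit multiple of `g_v` plus terms of smaller length
(`exists_leading_term`). Since `w ↦ v` is injective, `φ` is triangular with units on the diagonal,
hence injective over any commutative ring (`injective_of_leading_term`). -/

namespace AffineA

/-! ### Affine permutations of ℤ -/

variable {n : ℕ}

/-- The residue of an integer modulo `n + 1`. -/
def res (n : ℕ) (x : ℤ) : Fin (n + 1) := (x : ZMod (n + 1))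

theorem res_add (x y : ℤ) : res n (x + y) = res n x + res n y :=
  Int.cast_add (R := ZMod (n + 1)) x y

theorem res_sub (x y : ℤ) : res n (x - y) = res n x - res n y :=
  Int.cast_sub (R := ZMod (n + 1)) x y

@[simp] theorem res_one : res n 1 = 1 := Int.cast_one (R := ZMod (n + 1))

@[simp] theorem res_add_one (x : ℤ) : res n (x + 1) = res n x + 1 := by rw [res_add, res_one]

@[simp] theorem res_sub_one (x : ℤ) : res n (x - 1) = res n x - 1 := by rw [res_sub, res_one]

@[simp] theorem res_val (i : Fin (n + 1)) : res n (i.val : ℤ) = i := by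
  have h := ZMod.natCast_zmod_val (n := n + 1) i
  rw [← Int.cast_natCast] at h
  exact h

@[simp] theorem res_add_mul (x m : ℤ) : res n (x + m * (n + 1)) = res n x := by
  have h := ZMod.natCast_self (n + 1)
  change ((x + m * (n + 1) : ℤ) : ZMod (n + 1)) = (x : ZMod (n + 1))
  push_cast at h ⊢
  rw [h, mul_zero, add_zero]

theorem one_ne_zero_fin (hn : 1 ≤ n) : (1 : Fin (n + 1)) ≠ 0 := by
  obtain ⟨k, rfl⟩ := Nat.exists_eq_add_of_le' hn
  simp

theorem two_ne_zero_fin (hn : 2 ≤ n) : (1 + 1 : Fin (n + 1)) ≠ 0 := by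
  obtain ⟨k, rfl⟩ := Nat.exists_eq_add_of_le' hn
  intro h
  have h2 : (1 + 1) % (k + 2 + 1) = 0 := by simpa [Fin.ext_iff, Fin.val_add] using h
  rw [Nat.mod_eq_of_lt (by omega)] at h2
  omega

/-- The map exchanging `x` and `x + 1` for all `x ≡ i` modulo `n + 1`. -/
def step (i : Fin (n + 1)) (x : ℤ) : ℤ :=
  if res n x = i then x + 1 else if res n x = i + 1 then x - 1 else x

theorem step_of_eq {i : Fin (n + 1)} {x : ℤ} (h : res n x = i) : step i x = x + 1 := if_pos h

theorem step_of_eq_add (hn : 1 ≤ n) {i : Fin (n + 1)} {x : ℤ} (h : res n x = i + 1) :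
    step i x = x - 1 := by
  rw [step, if_neg, if_pos h]
  rw [h]
  simpa using one_ne_zero_fin hn

theorem step_add_one (hn : 1 ≤ n) {i : Fin (n + 1)} {x : ℤ} (h : res n x = i) :
    step i (x + 1) = x := by
  rw [step_of_eq_add hn (by simp [h])]; ring

theorem step_of_ne {i : Fin (n + 1)} {x : ℤ} (h : res n x ≠ i) (h' : res n x ≠ i + 1) :
    step i x = x := by rw [step, if_neg h, if_neg h']

theorem step_add_mul (i : Fin (n + 1)) (x m : ℤ) :
    step i (x + m * (n + 1)) = step i x + m * (n + 1) := by
  simp only [step, res_add_mul]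
  split_ifs <;> ring

theorem step_step (hn : 1 ≤ n) (i : Fin (n + 1)) (x : ℤ) : step i (step i x) = x := by
  by_cases h : res n x = i
  · rw [step_of_eq h, step_add_one hn h]
  · by_cases h1 : res n x = i + 1
    · rw [step_of_eq_add hn h1, step_of_eq (by simp [h1])]; ring
    · rw [step_of_ne h h1, step_of_ne h h1]

/-- `step j` fixes the integers exchanged by `step i` if `i` and `j` are not adjacent. -/
theorem step_of_far {i j : Fin (n + 1)} (h : i ≠ j) (h1 : j ≠ i + 1) (h2 : i ≠ j + 1)
    {x : ℤ} (hx : res n x = i) : step j x = x ∧ step j (x + 1) = x + 1 := by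
  refine ⟨step_of_ne (by rwa [hx]) (by rwa [hx]), step_of_ne ?_ ?_⟩ <;> rw [res_add_one, hx]
  · exact h1.symm
  · simpa using h

theorem step_comm (hn : 1 ≤ n) {i j : Fin (n + 1)} (h : i ≠ j) (h1 : j ≠ i + 1) (h2 : i ≠ j + 1)
    (x : ℤ) : step i (step j x) = step j (step i x) := by
  have key : ∀ (i j : Fin (n + 1)) y, i ≠ j → j ≠ i + 1 → i ≠ j + 1 → res n y = i →
      step i (step j y) = step j (step i y) ∧
      step i (step j (y + 1)) = step j (step i (y + 1)) := by
    intro i j y h h1 h2 hy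
    obtain ⟨k1, k2⟩ := step_of_far h h1 h2 hy
    simp only [step_of_eq hy, step_add_one hn hy, k1, k2, and_self]
  by_cases hi : res n x = i
  · exact (key i j x h h1 h2 hi).1
  by_cases hi1 : res n x = i + 1
  · simpa using (key i j (x - 1) h h1 h2 (by simp [hi1])).2
  by_cases hj : res n x = j
  · exact (key j i x h.symm h2 h1 hj).1.symm
  by_cases hj1 : res n x = j + 1
  · simpa using (key j i (x - 1) h.symm h2 h1 (by simp [hj1])).2.symm
  rw [step_of_ne hi hi1, step_of_ne hj hj1, step_of_ne hi hi1]

/-- The values of `step i` and `step (i + 1)` on the three integers they move. -/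
theorem step_values (hn : 2 ≤ n) {i j : Fin (n + 1)} (h : j = i + 1) {y : ℤ} (hy : res n y = i) :
      step i y = y + 1 ∧ step i (y + 1) = y ∧ step i (y + 1 + 1) = y + 1 + 1 ∧
      step j y = y ∧ step j (y + 1) = y + 1 + 1 ∧ step j (y + 1 + 1) = y + 1 := by
  have e1 := one_ne_zero_fin (n := n) (by omega)
  have e2 := two_ne_zero_fin hn
  have hn1 : 1 ≤ n := by omega
  subst h
  refine ⟨step_of_eq hy, step_add_one hn1 hy, step_of_ne ?_ ?_, step_of_ne ?_ ?_,
    step_of_eq (by simp [hy]), step_add_one hn1 (by simp [hy])⟩ <;>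
  simp only [res_add_one, hy]
  · rwa [add_assoc, Ne, add_eq_left]
  · rwa [Ne, add_eq_left]
  · rwa [Ne, left_eq_add]
  · rwa [add_assoc, Ne, left_eq_add]

theorem step_braid (hn : 2 ≤ n) {i j : Fin (n + 1)} (h : j = i + 1) (x : ℤ) :
    step i (step j (step i x)) = step j (step i (step j x)) := by
  by_cases h0 : res n x = i
  · obtain ⟨k1, -, k3, k4, k5, -⟩ := step_values hn h h0
    simp only [k1, k3, k4, k5]
  by_cases h1 : res n x = i + 1
  · obtain ⟨y, rfl⟩ : ∃ y, x = y + 1 := ⟨x - 1, by ring⟩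
    obtain ⟨k1, k2, k3, k4, k5, k6⟩ := step_values hn h (y := y) (by simpa using h1)
    simp only [k1, k2, k3, k4, k5, k6]
  by_cases h2 : res n x = i + 1 + 1
  · obtain ⟨y, rfl⟩ : ∃ y, x = y + 1 + 1 := ⟨x - 1 - 1, by ring⟩
    obtain ⟨k1, k2, k3, k4, k5, k6⟩ := step_values hn h (y := y) (by simpa using h2)
    simp only [k2, k3, k4, k6]
  have k1 : step i x = x := step_of_ne h0 h1
  have k2 : step j x = x := step_of_ne (by rwa [h]) (by rwa [h])
  simp only [k1, k2]

/-- The permutation `step i` of `ℤ`. -/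
def stepPerm (hn : 1 ≤ n) (i : Fin (n + 1)) : Equiv.Perm ℤ :=
  Function.Involutive.toPerm (step i) (step_step hn i)

theorem affineA_apply (i j : Fin (n + 1)) : (CoxeterMatrix.affineA n).M i j =
    if i = j then 1 else if n = 1 then 0 else if j = i + 1 ∨ i = j + 1 then 3 else 2 := rfl

theorem mul_pow_three_of_braid {G : Type*} [Group G] {a b : G} (ha : a * a = 1) (hb : b * b = 1)
    (h : a * b * a = b * a * b) : (a * b) ^ 3 = 1 := by
  calc (a * b) ^ 3 = a * b * a * (b * a * b) := by simp [pow_succ, mul_assoc]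
    _ = a * b * a * (a * b * a) := by rw [h]
    _ = a * (b * (a * a) * b) * a := by simp only [mul_assoc]
    _ = 1 := by rw [ha, mul_one, hb, mul_one, ha]

theorem stepPerm_isLiftable (hn : 1 ≤ n) :
    (CoxeterMatrix.affineA n).IsLiftable (stepPerm hn) := by
  have hs : ∀ i, stepPerm hn i * stepPerm hn i = 1 := fun i => Equiv.ext (step_step hn i)
  have hb : ∀ i j, 2 ≤ n → j = i + 1 → (stepPerm hn i * stepPerm hn j) ^ 3 = 1 := by
    intro i j h2 hj
    exact mul_pow_three_of_braid (hs i) (hs j) (Equiv.ext (step_braid h2 hj))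
  intro i j
  rw [affineA_apply]
  split_ifs with h1 h2 h3
  · rw [h1, pow_one, hs]
  -- For `n = 1` the matrix entry is `0`, so there is no relation to check.
  · rw [pow_zero]
  · rcases h3 with h3 | h3
    · exact hb i j (by omega) h3
    · have := hb j i (by omega) h3
      have h4 : stepPerm hn i * stepPerm hn j = (stepPerm hn j * stepPerm hn i)⁻¹ := by
        rw [mul_inv_rev, ← mul_eq_one_iff_eq_inv.1 (hs i), ← mul_eq_one_iff_eq_inv.1 (hs j)]
      rw [h4, inv_pow, this, inv_one]
  · push Not at h3
    have h4 : stepPerm hn i * stepPerm hn j = stepPerm hn j * stepPerm hn i :=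
      Equiv.ext (step_comm hn h1 h3.1 h3.2)
    rw [pow_two]
    nth_rw 2 [h4]
    rw [mul_assoc, ← mul_assoc (stepPerm hn j), hs, one_mul, hs]

/-- The action of `W(Ã_n)` on `ℤ` by affine permutations. -/
def rep (hn : 1 ≤ n) : W n →* Equiv.Perm ℤ := (cs n).lift ⟨stepPerm hn, stepPerm_isLiftable hn⟩

@[simp] theorem rep_simple (hn : 1 ≤ n) (i : Fin (n + 1)) (x : ℤ) :
    rep hn ((cs n).simple i) x = step i x := by
  rw [rep, CoxeterSystem.lift_apply_simple]; rfl

theorem rep_mul_simple (hn : 1 ≤ n) (w : W n) (i : Fin (n + 1)) (x : ℤ) :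
    rep hn (w * (cs n).simple i) x = rep hn w (step i x) := by
  rw [map_mul, Equiv.Perm.mul_apply, rep_simple]

theorem rep_add_mul (hn : 1 ≤ n) (w : W n) (x m : ℤ) :
    rep hn w (x + m * (n + 1)) = rep hn w x + m * (n + 1) := by
  induction w using (cs n).simple_induction_right generalizing x with
  | one => simp
  | mul_simple_right w i ih => rw [rep_mul_simple, rep_mul_simple, step_add_mul, ih]

theorem simple_comm {i j : Fin (n + 1)} (h1 : j ≠ i + 1) (h2 : i ≠ j + 1) (h3 : n ≠ 1) :
    (cs n).simple i * (cs n).simple j = (cs n).simple j * (cs n).simple i := by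
  by_cases h : i = j
  · rw [h]
  have := (cs n).simple_mul_simple_pow i j
  change _ ^ (CoxeterMatrix.affineA n).M i j = 1 at this
  rw [affineA_apply, if_neg h, if_neg h3, if_neg (by tauto), pow_two] at this
  have := eq_inv_of_mul_eq_one_left this
  rwa [mul_inv_rev, CoxeterSystem.inv_simple, CoxeterSystem.inv_simple] at this

theorem simple_braid {i j : Fin (n + 1)} (h : j = i + 1 ∨ i = j + 1) (h3 : n ≠ 1) :
    (cs n).simple i * (cs n).simple j * (cs n).simple i =
      (cs n).simple j * (cs n).simple i * (cs n).simple j := by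
  by_cases hij : i = j
  · rw [hij]
  have := (cs n).simple_mul_simple_pow i j
  change _ ^ (CoxeterMatrix.affineA n).M i j = 1 at this
  rw [affineA_apply, if_neg hij, if_neg h3, if_pos h, pow_succ, pow_two] at this
  have h4 : (cs n).simple i * (cs n).simple j * (cs n).simple i *
    ((cs n).simple j * (cs n).simple i * (cs n).simple j) = 1 := by
    rw [← this]; simp only [mul_assoc]
  have := eq_inv_of_mul_eq_one_left h4
  rwa [mul_inv_rev, mul_inv_rev, CoxeterSystem.inv_simple, CoxeterSystem.inv_simple,
    ← mul_assoc] at this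

/-! ### Descents in terms of affine permutations -/

/-- Induction on length: strip a right descent `j ≠ i`, writing `w = v s_j`, and compare `v`, or a
still shorter element, on neighbouring integers. The cases are those of the dihedral group generated
by `s_i` and `s_j`. -/
theorem rep_lt_of_not_isRightDescent (hn : 1 ≤ n) {w : W n} {i : Fin (n + 1)}
    (hw : ¬ (cs n).IsRightDescent w i) {x : ℤ} (hx : res n x = i) :
    rep hn w x < rep hn w (x + 1) := by
  induction hl : (cs n).length w using Nat.strong_induction_on generalizing w i x with
  | _ l ih =>
  subst hl
  by_cases h1 : w = 1
  · simp [h1]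
  obtain ⟨j, hj⟩ := (cs n).exists_rightDescent_of_ne_one h1
  have hij : i ≠ j := by rintro rfl; exact hw hj
  obtain ⟨v, rfl⟩ : ∃ v, w = v * (cs n).simple j :=
      ⟨w * (cs n).simple j, ((cs n).simple_mul_simple_cancel_right j).symm⟩
  have hvj : ¬ (cs n).IsRightDescent v j := by
    have := (cs n).isRightDescent_iff_not_isRightDescent_mul.1 hj
    rwa [CoxeterSystem.simple_mul_simple_cancel_right] at this
  have lv := (cs n).not_isRightDescent_iff.1 hvj
  have lw := (cs n).not_isRightDescent_iff.1 hw
  rw [rep_mul_simple, rep_mul_simple]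
  by_cases hn1 : n = 1
  · subst hn1
    have hj1 : j = i + 1 := by clear * - hij; revert i j; decide
    have hi1 : i = j + 1 := by clear * - hij; revert i j; decide
    have hx1 : res 1 (x - 1) = j := by simp [hx, hi1]
    have e1 : step j x = x - 1 := step_of_eq_add hn (by rw [hx, hi1])
    have e2 : step j (x + 1) = x + 1 * ((1 : ℕ) + 1) := by
      rw [step_of_eq (by simp [hx, hj1])]; push_cast; ring
    have := ih _ (by omega) hvj hx1 rfl
    rw [e1, e2, rep_add_mul]
    simp only [sub_add_cancel] at this
    push_cast
    omega
  have hn2 : 2 ≤ n := by omega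
  by_cases hadj : j = i + 1 ∨ i = j + 1
  · by_cases hvi : (cs n).IsRightDescent v i
    -- Here `w = u s_i s_j`, and `s_i s_j` carries `x, x + 1` in order to a pair exchanged by `s_j`,
    -- so the claim becomes the one for `u` and `j`.
    · obtain ⟨u, rfl⟩ : ∃ u, v = u * (cs n).simple i :=
      ⟨v * (cs n).simple i, ((cs n).simple_mul_simple_cancel_right i).symm⟩
      have lu := (cs n).isRightDescent_iff.1 hvi
      rw [CoxeterSystem.simple_mul_simple_cancel_right] at lu
      -- If `u = t s_j`, the braid relation gives `w s_i = t s_i s_j`, too short for `i` not to be a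
      -- descent of `w`.
      have huj : ¬ (cs n).IsRightDescent u j := by
        intro h
        have h1 := (cs n).isRightDescent_iff.1 h
        obtain ⟨t, rfl⟩ : ∃ t, u = t * (cs n).simple j :=
      ⟨u * (cs n).simple j, ((cs n).simple_mul_simple_cancel_right j).symm⟩
        have e : t * (cs n).simple j * (cs n).simple i * (cs n).simple j * (cs n).simple i =
            t * (cs n).simple i * (cs n).simple j := by
          rw [mul_assoc t, mul_assoc t, ← simple_braid hadj hn1, mul_assoc t,
            CoxeterSystem.simple_mul_simple_cancel_right, mul_assoc]
        rw [e] at lw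
        rw [CoxeterSystem.simple_mul_simple_cancel_right] at h1
        have l1 := (cs n).length_mul_simple t i
        have l2 := (cs n).length_mul_simple (t * (cs n).simple i) j
        omega
      rw [rep_mul_simple, rep_mul_simple]
      rcases hadj with h | h
      · obtain ⟨k1, k2, k3, k4, k5, k6⟩ := step_values hn2 h hx
        rw [k4, k5, k1, k3]
        exact ih _ (by omega) huj (by simp [hx, h]) rfl
      · have hx1 : res n (x - 1) = j := by simp [hx, h]
        obtain ⟨k1, k2, k3, k4, k5, k6⟩ := step_values hn2 h hx1
        simp only [sub_add_cancel] at k1 k2 k3 k4 k5 k6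
        rw [k2, k3, k4, k6]
        simpa using ih _ (by omega) huj hx1 rfl
    -- Neither `i` nor `j` is a descent of `v`, so `v` increases on three consecutive integers, two
    -- of which carry the values `w x` and `w (x + 1)`.
    · have a1 := ih _ (by omega) hvi hx rfl
      rcases hadj with h | h
      · obtain ⟨k1, k2, k3, k4, k5, k6⟩ := step_values hn2 h hx
        rw [k4, k5]
        exact a1.trans (ih _ (by omega) hvj (by simp [hx, h]) rfl)
      · have hx1 : res n (x - 1) = j := by simp [hx, h]
        obtain ⟨k1, k2, k3, k4, k5, k6⟩ := step_values hn2 h hx1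
        simp only [sub_add_cancel] at k1 k2 k3 k4 k5 k6
        rw [k2, k3]
        have a2 := ih _ (by omega) hvj hx1 rfl
        rw [sub_add_cancel] at a2
        exact a2.trans a1
  · push Not at hadj
    obtain ⟨k1, k2⟩ := step_of_far hij hadj.1 hadj.2 hx
    rw [k1, k2]
    refine ih _ (by omega) ?_ hx rfl
    intro h
    have h1 := (cs n).isRightDescent_iff.1 h
    rw [mul_assoc, ← simple_comm hadj.1 hadj.2 hn1, ← mul_assoc] at lw
    have l1 := (cs n).length_mul_simple (v * (cs n).simple i) j
    omega

theorem isRightDescent_iff_rep_lt (hn : 1 ≤ n) {w : W n} {i : Fin (n + 1)} {x : ℤ}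
    (hx : res n x = i) : (cs n).IsRightDescent w i ↔ rep hn w (x + 1) < rep hn w x := by
  constructor
  · intro h
    have := rep_lt_of_not_isRightDescent hn
      ((cs n).isRightDescent_iff_not_isRightDescent_mul.1 h) hx
    rwa [rep_mul_simple, rep_mul_simple, step_of_eq hx, step_add_one hn hx] at this
  · intro h
    by_contra h'
    exact absurd (rep_lt_of_not_isRightDescent hn h' hx) (by omega)

theorem not_isRightDescent_iff_rep_lt (hn : 1 ≤ n) {w : W n} {i : Fin (n + 1)} {x : ℤ}
    (hx : res n x = i) : ¬ (cs n).IsRightDescent w i ↔ rep hn w x < rep hn w (x + 1) :=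
  ⟨fun h => rep_lt_of_not_isRightDescent hn h hx,
    fun h h' => absurd ((isRightDescent_iff_rep_lt hn hx).1 h') (by omega)⟩

/-- A nontrivial element has a right descent, which the identity permutation does not. -/
theorem rep_injective (hn : 1 ≤ n) : Function.Injective (rep hn) := by
  refine (injective_iff_map_eq_one _).2 fun w hw => ?_
  by_contra h
  obtain ⟨i, hi⟩ := (cs n).exists_rightDescent_of_ne_one h
  rw [isRightDescent_iff_rep_lt hn (res_val i), hw] at hi
  simp at hi

end AffineA

/-! ### Right multiplication and leading terms in Hecke algebras -/

namespace HeckeAlgebra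

section

variable {B W K : Type*} [Group W] [CommRing K] {M : CoxeterMatrix B}
  (cs : CoxeterSystem M W) (q : K)

/-- The algebra is defined by left multiplication. Peeling off a left descent of `w` and using
associativity transfers the rule to the right. -/
theorem g_mul_g_simple_of_not_isRightDescent {w : W} {i : B} (h : ¬ cs.IsRightDescent w i) :
    g cs q w * g cs q (cs.simple i) = g cs q (w * cs.simple i) := by
  induction hl : cs.length w using Nat.strong_induction_on generalizing w with
  | _ l ih =>
  subst hl
  by_cases h1 : w = 1
  · rw [h1, g_one, one_mul, one_mul]
  obtain ⟨j, hj⟩ := cs.exists_leftDescent_of_ne_one h1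
  obtain ⟨v, rfl⟩ : ∃ v, w = cs.simple j * v := ⟨cs.simple j * w, by simp⟩
  have hv : ¬ cs.IsLeftDescent v j := by
    simpa using cs.isLeftDescent_iff_not_isLeftDescent_mul.1 hj
  have l1 := cs.not_isLeftDescent_iff.1 hv
  have l2 := cs.not_isRightDescent_iff.1 h
  rw [mul_assoc] at l2
  have l3 := cs.length_mul_simple v i
  have l4 := cs.length_simple_mul (v * cs.simple i) j
  have h3 : ¬ cs.IsRightDescent v i := by rw [cs.not_isRightDescent_iff]; omega
  have h4 : ¬ cs.IsLeftDescent (v * cs.simple i) j := by rw [cs.not_isLeftDescent_iff]; omega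
  rw [← g_simple_mul_g_of_not_isLeftDescent cs q hv, mul_assoc, ih _ (by omega) h3 rfl,
    g_simple_mul_g_of_not_isLeftDescent cs q h4, mul_assoc]

theorem g_mul_simple_mul_g_simple {w : W} {i : B} (h : cs.IsRightDescent w i) :
    g cs q (w * cs.simple i) * g cs q (cs.simple i) = g cs q w := by
  rw [g_mul_g_simple_of_not_isRightDescent cs q
    (cs.isRightDescent_iff_not_isRightDescent_mul.1 h), cs.simple_mul_simple_cancel_right]

theorem g_mul_g_simple_of_isRightDescent {w : W} {i : B} (h : cs.IsRightDescent w i) :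
    g cs q w * g cs q (cs.simple i) = q • g cs q (w * cs.simple i) + (q - 1) • g cs q w := by
  have h1 := g_mul_simple_mul_g_simple cs q h
  conv_lhs => rw [← h1]
  rw [mul_assoc, g_simple_mul_self, mul_add, mul_smul_comm, mul_smul_comm, mul_one, h1]

@[elab_as_elim]
theorem g_induction {p : HeckeAlgebra cs q → Prop} (x : HeckeAlgebra cs q) (zero : p 0)
    (add : ∀ x y, p x → p y → p (x + y)) (smul : ∀ (a : K) x, p x → p (a • x))
    (basis : ∀ w, p (g cs q w)) : p x := by
  have hx : x ∈ Submodule.span K (Set.range (g cs q)) := by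
    rw [Module.Basis.span_eq]; exact Submodule.mem_top
  induction hx using Submodule.span_induction with
  | mem x hx => obtain ⟨w, rfl⟩ := hx; exact basis w
  | zero => exact zero
  | add x y _ _ hx hy => exact add x y hx hy
  | smul a x _ hx => exact smul a x hx

/-- A linear map that turns right multiplication by generators into multiplication is
multiplicative. -/
theorem map_mul_of_map_mul_simple {A : Type*} [Ring A] [Algebra K A]
    (Φ : HeckeAlgebra cs q →ₗ[K] A) (f : B → A) (h1 : Φ 1 = 1)
    (h : ∀ x i, Φ (x * g cs q (cs.simple i)) = Φ x * f i) (x y : HeckeAlgebra cs q) :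
    Φ (x * y) = Φ x * Φ y := by
  induction y using g_induction cs q with
  | zero => simp
  | add y z hy hz => rw [mul_add, map_add, map_add, mul_add, hy, hz]
  | smul a y hy => rw [mul_smul_comm, map_smul, map_smul, hy, mul_smul_comm]
  | basis w =>
    induction hl : cs.length w using Nat.strong_induction_on generalizing w with
    | _ l ih =>
    subst hl
    by_cases hw : w = 1
    · rw [hw, g_one, h1, mul_one, mul_one]
    obtain ⟨j, hj⟩ := cs.exists_rightDescent_of_ne_one hw
    have e := g_mul_simple_mul_g_simple cs q hj
    rw [← e, ← mul_assoc, h, h, ih _ hj _ rfl, mul_assoc]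

/-- An algebra morphism is determined by its values at the generators. -/
theorem algHom_ext {A : Type*} [Ring A] [Algebra K A] {φ ψ : HeckeAlgebra cs q →ₐ[K] A}
    (h : ∀ i, φ (g cs q (cs.simple i)) = ψ (g cs q (cs.simple i))) : φ = ψ := by
  suffices φ.toLinearMap = ψ.toLinearMap from AlgHom.toLinearMap_injective this
  refine (g cs q).ext fun w => ?_
  change φ _ = ψ _
  induction hl : cs.length w using Nat.strong_induction_on generalizing w with
  | _ l ih =>
  subst hl
  by_cases hw : w = 1
  · rw [hw, g_one, map_one, map_one]
  obtain ⟨j, hj⟩ := cs.exists_rightDescent_of_ne_one hw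
  have e := g_mul_simple_mul_g_simple cs q hj
  rw [← e, map_mul φ, map_mul ψ, ih _ hj _ rfl, h]

/-- The span of the `g_w` with `ℓ(w) < l`. -/
noncomputable def filt (l : ℕ) : Submodule K (HeckeAlgebra cs q) :=
  Submodule.span K (g cs q '' {w | cs.length w < l})

theorem g_mem_filt {w : W} {l : ℕ} (h : cs.length w < l) : g cs q w ∈ filt cs q l :=
  Submodule.subset_span ⟨w, h, rfl⟩

theorem filt_mono {l m : ℕ} (h : l ≤ m) : filt cs q l ≤ filt cs q m :=
  Submodule.span_mono (Set.image_mono fun _ hw => lt_of_lt_of_le hw h)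

theorem mul_g_simple_mem_filt {l : ℕ} {x : HeckeAlgebra cs q} (hx : x ∈ filt cs q l) (i : B) :
    x * g cs q (cs.simple i) ∈ filt cs q (l + 1) := by
  induction hx using Submodule.span_induction with
  | mem x hx =>
    obtain ⟨w, hw, rfl⟩ := hx
    have hw : cs.length w < l := hw
    have := cs.length_mul_simple w i
    by_cases h : cs.IsRightDescent w i
    · rw [g_mul_g_simple_of_isRightDescent cs q h]
      exact add_mem (Submodule.smul_mem _ _ (g_mem_filt cs q (by omega)))
        (Submodule.smul_mem _ _ (g_mem_filt cs q (by omega)))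
    · rw [g_mul_g_simple_of_not_isRightDescent cs q h]
      exact g_mem_filt cs q (by omega)
  | zero => rw [zero_mul]; exact zero_mem _
  | add x y _ _ hx hy => rw [add_mul]; exact add_mem hx hy
  | smul a x _ hx => rw [smul_mul_assoc]; exact Submodule.smul_mem _ _ hx

theorem repr_eq_zero_of_mem_filt {l : ℕ} {x : HeckeAlgebra cs q} (hx : x ∈ filt cs q l)
    {w : W} (hw : l ≤ cs.length w) : (g cs q).repr x w = 0 := by
  classical
  induction hx using Submodule.span_induction with
  | mem x hx =>
    obtain ⟨v, hv, rfl⟩ := hx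
    rw [Module.Basis.repr_self, Finsupp.single_apply, if_neg]
    rintro rfl
    exact absurd hv (not_lt.2 hw)
  | zero => simp
  | add x y _ _ hx hy => simp [hx, hy]
  | smul a x _ hx => simp [hx]

end

variable {B W K : Type*} [Group W] [CommRing K] {M : CoxeterMatrix B}
  (cs : CoxeterSystem M W) (q : Kˣ)

theorem isUnit_g (w : W) : IsUnit (g cs (q : K) w) := by
  induction hl : cs.length w using Nat.strong_induction_on generalizing w with
  | _ l ih =>
  subst hl
  by_cases hw : w = 1
  · rw [hw, g_one]; exact isUnit_one
  obtain ⟨j, hj⟩ := cs.exists_rightDescent_of_ne_one hw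
  have e := g_mul_simple_mul_g_simple cs (q : K) hj
  rw [← e]
  exact (ih _ hj _ rfl).mul (gUnit cs q j).isUnit

/-- The element `g_x⁻¹ g_{xw}` has leading term a unit multiple of `g_w`. -/
theorem exists_leading_term (x w : W) : ∃ (h : HeckeAlgebra cs (q : K)) (u : Kˣ),
    g cs (q : K) x * h = g cs (q : K) (x * w) ∧
      h - (u : K) • g cs (q : K) w ∈ filt cs (q : K) (cs.length w) := by
  induction hl : cs.length w using Nat.strong_induction_on generalizing w with
  | _ l ih =>
  subst hl
  by_cases hw : w = 1
  · exact ⟨1, 1, by simp [hw], by simp [hw, g_one]⟩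
  obtain ⟨j, hj⟩ := cs.exists_rightDescent_of_ne_one hw
  obtain ⟨v, rfl⟩ : ∃ v, w = v * cs.simple j := ⟨w * cs.simple j, by simp⟩
  have hv : ¬ cs.IsRightDescent v j := by
    simpa using cs.isRightDescent_iff_not_isRightDescent_mul.1 hj
  have lv := cs.not_isRightDescent_iff.1 hv
  obtain ⟨h, u, h1, h2⟩ := ih _ (by omega) v rfl
  have h3 := mul_g_simple_mem_filt cs (q : K) h2 j
  rw [sub_mul, smul_mul_assoc, g_mul_g_simple_of_not_isRightDescent cs _ hv, ← lv] at h3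
  by_cases hd : cs.IsRightDescent (x * v) j
  -- When `x v s_j` is shorter than `x v`, the factor to append is `g_s⁻¹ = q⁻¹ (g_s - (q - 1))`.
  -- Its leading coefficient `q⁻¹` enters the unit, and the constant term contributes only terms of
  -- length at most `ℓ(v)`.
  · refine ⟨h * ↑(gUnit cs q j)⁻¹, q⁻¹ * u, ?_, ?_⟩
    · rw [← mul_assoc, h1, ← mul_assoc, Units.mul_inv_eq_iff_eq_mul]
      change _ = _ * g cs (q : K) (cs.simple j)
      rw [g_mul_simple_mul_g_simple cs _ hd]
    · have e : (↑(gUnit cs q j)⁻¹ : HeckeAlgebra cs (q : K)) =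
        (↑q⁻¹ : K) • (g cs (q : K) (cs.simple j) - ((q : K) - 1) • 1) := rfl
      have h4 : h ∈ filt cs (q : K) (cs.length (v * cs.simple j)) := by
        rw [← sub_add_cancel h ((u : K) • g cs (q : K) v)]
        exact add_mem (filt_mono cs _ (by omega) h2)
          (Submodule.smul_mem _ _ (g_mem_filt cs _ (by omega)))
      have e2 : h * ↑(gUnit cs q j)⁻¹ - ((q⁻¹ * u : Kˣ) : K) • g cs (q : K) (v * cs.simple j) =
          (↑q⁻¹ : K) • ((h * g cs (q : K) (cs.simple j) -
            (u : K) • g cs (q : K) (v * cs.simple j)) - ((q : K) - 1) • h) := by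
        rw [e, mul_smul_comm, mul_sub, mul_smul_comm, mul_one, Units.val_mul]
        module
      rw [e2]
      exact Submodule.smul_mem _ _ (sub_mem h3 (Submodule.smul_mem _ _ h4))
  · refine ⟨h * g cs (q : K) (cs.simple j), u, ?_, h3⟩
    rw [← mul_assoc, h1, g_mul_g_simple_of_not_isRightDescent cs _ hd, mul_assoc]

theorem sub_mem_filt_of_g_mul_eq {x w : W} {h : HeckeAlgebra cs (q : K)}
    (hh : g cs (q : K) x * h = g cs (q : K) (x * w)) :
    ∃ u : Kˣ, h - (u : K) • g cs (q : K) w ∈ filt cs (q : K) (cs.length w) := by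
  obtain ⟨h', u, h1, h2⟩ := exists_leading_term cs q x w
  rw [(isUnit_g cs q x).mul_left_cancel (hh.trans h1.symm)]
  exact ⟨u, h2⟩

end HeckeAlgebra

/-- A linear map that is unitriangular up to units with respect to an injective relabelling of
the basis is injective. -/
theorem HeckeAlgebra.injective_of_leading_term {B W B' W' K : Type*} [Group W] [Group W']
    [CommRing K] {M : CoxeterMatrix B} {M' : CoxeterMatrix B'} (cs : CoxeterSystem M W)
    (cs' : CoxeterSystem M' W') (q q' : K) (φ : HeckeAlgebra cs q →ₗ[K] HeckeAlgebra cs' q')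
    (v : W → W') (hv : Function.Injective v)
    (h : ∀ w, ∃ u : Kˣ, φ (g cs q w) - (u : K) • g cs' q' (v w) ∈
      filt cs' q' (cs'.length (v w))) : Function.Injective φ := by
  classical
  choose u hu using h
  rw [injective_iff_map_eq_zero]
  intro x hx
  by_contra hx0
  have hne : ((g cs q).repr x).support.Nonempty := by
    rw [Finsupp.support_nonempty_iff]; simpa using hx0
  -- With `v w` of maximal length over the support of `x`, no other term reaches `g_{v w}`: lower
  -- terms are too short, and leading terms differ since `v` is injective. The coefficient of `g_{v
  -- w}` in `φ x` is thus a unit times that of `w` in `x`.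
  obtain ⟨w, hw, hmax⟩ := Finset.exists_max_image _ (fun w => cs'.length (v w)) hne
  have key : ∀ w' ∈ ((g cs q).repr x).support, w' ≠ w →
      (g cs' q').repr (φ (g cs q w')) (v w) = 0 := by
    intro w' hw' hne
    rw [← sub_add_cancel (φ (g cs q w')) ((u w' : K) • g cs' q' (v w')), map_add,
      Finsupp.add_apply, repr_eq_zero_of_mem_filt cs' q' (hu w') (hmax w' hw'), map_smul,
      Module.Basis.repr_self, Finsupp.smul_apply, Finsupp.single_apply,
      if_neg (fun h => hne (hv h))]
    simp
  have key' : (g cs' q').repr (φ (g cs q w)) (v w) = u w := by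
    rw [← sub_add_cancel (φ (g cs q w)) ((u w : K) • g cs' q' (v w)), map_add,
      Finsupp.add_apply, repr_eq_zero_of_mem_filt cs' q' (hu w) le_rfl, map_smul,
      Module.Basis.repr_self, Finsupp.smul_apply, Finsupp.single_apply, if_pos rfl]
    simp
  have h0 : (g cs' q').repr (φ x) (v w) = 0 := by rw [hx]; simp
  rw [← (g cs q).linearCombination_repr x, Finsupp.linearCombination_apply, Finsupp.sum, map_sum,
    map_sum, Finsupp.finsetSum_apply, Finset.sum_eq_single w] at h0
  · rw [map_smul, map_smul, Finsupp.smul_apply, key', smul_eq_mul, Units.mul_left_eq_zero] at h0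
    exact (Finsupp.mem_support_iff.1 hw) h0
  · intro w' hw' hne
    rw [map_smul, map_smul, Finsupp.smul_apply, key w' hw' hne, smul_zero]
  · exact fun h => absurd hw h

/-! ### The universal property of the Hecke algebra of affine type `A` -/

namespace AffineA

variable {n : ℕ}

/-- Two descents would give `w x > w (x + 1) > w (x + 2)`, against `w (x + 2) = w x + 2`. -/
theorem not_isRightDescent_both (hn : n = 1) {w : W n} {i j : Fin (n + 1)} (hij : i ≠ j)
    (hi : (cs n).IsRightDescent w i) : ¬ (cs n).IsRightDescent w j := by
  subst hn
  have hj1 : j = i + 1 := by clear * - hij; revert i j; decide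
  rw [isRightDescent_iff_rep_lt le_rfl (res_val i)] at hi
  rw [not_isRightDescent_iff_rep_lt le_rfl (x := i.val + 1) (by simp [hj1])]
  have := rep_add_mul le_rfl w i.val 1
  push_cast at this
  rw [show (i.val : ℤ) + 1 + 1 = i.val + 2 by ring]
  omega

theorem isRightDescent_mul_of_far (hn : 1 ≤ n) {w : W n} {i j : Fin (n + 1)} (hij : i ≠ j)
    (h1 : j ≠ i + 1) (h2 : i ≠ j + 1) (hj : (cs n).IsRightDescent w j) :
    (cs n).IsRightDescent (w * (cs n).simple i) j := by
  have hx := res_val j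
  obtain ⟨k1, k2⟩ := step_of_far hij.symm h2 h1 hx
  rw [isRightDescent_iff_rep_lt hn hx] at hj ⊢
  rwa [rep_mul_simple, rep_mul_simple, k1, k2]

/-- Two adjacent descents mean that `w` decreases along three consecutive integers; these three
values can be sorted starting with either generator. -/
theorem isRightDescent_mul_of_adj (hn : 2 ≤ n) {w : W n} {i j : Fin (n + 1)}
    (h : j = i + 1 ∨ i = j + 1) (hi : (cs n).IsRightDescent w i)
    (hj : (cs n).IsRightDescent w j) :
    (cs n).IsRightDescent (w * (cs n).simple i) j ∧
      (cs n).IsRightDescent (w * (cs n).simple i * (cs n).simple j) i := by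
  have hn1 : 1 ≤ n := by omega
  rcases h with h | h
  · have hx := res_val i
    have hx1 : res n (i.val + 1) = j := by simp [h]
    obtain ⟨k1, k2, k3, k4, k5, k6⟩ := step_values hn h hx
    rw [isRightDescent_iff_rep_lt hn1 hx] at hi ⊢
    rw [isRightDescent_iff_rep_lt hn1 hx1] at hj ⊢
    simp only [rep_mul_simple, k1, k2, k3, k4, k5]
    exact ⟨hj.trans hi, hj⟩
  · have hx := res_val j
    have hx1 : res n (j.val + 1) = i := by simp [h]
    obtain ⟨k1, k2, k3, k4, k5, k6⟩ := step_values hn h hx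
    rw [isRightDescent_iff_rep_lt hn1 hx] at hj ⊢
    rw [isRightDescent_iff_rep_lt hn1 hx1] at hi ⊢
    simp only [rep_mul_simple, k2, k3, k4, k5, k6]
    exact ⟨hi.trans hj, hj⟩

/-- The braid relations of type `Ã_n` for a family of elements of a monoid. -/
def BraidRel {A : Type*} [Monoid A] (f : Fin (n + 1) → A) : Prop :=
  n ≠ 1 → ∀ i j, i ≠ j →
    (j = i + 1 ∨ i = j + 1 → f i * f j * f i = f j * f i * f j) ∧
    (j ≠ i + 1 → i ≠ j + 1 → f i * f j = f j * f i)

section Word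

variable {A : Type*} [Monoid A]

open Classical in
/-- The product of the `f i` along a reduced word of `w`. -/
noncomputable def wordFun (f : Fin (n + 1) → A) (w : W n) : A :=
  if h : w = 1 then 1 else
    wordFun f (w * (cs n).simple ((cs n).exists_rightDescent_of_ne_one h).choose) *
      f ((cs n).exists_rightDescent_of_ne_one h).choose
termination_by (cs n).length w
decreasing_by exact ((cs n).exists_rightDescent_of_ne_one h).choose_spec

theorem wordFun_one (f : Fin (n + 1) → A) : wordFun f 1 = 1 := by
  rw [wordFun, dif_pos rfl]

/-- Independence of the reduced word, as in Matsumoto's theorem. Two distinct descents `i`, `j` of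
`w` allow a reduced word to end in either side of the relation between `s_i` and `s_j`. The
induction hypothesis applies to the shorter elements and the same relation for `f` matches the ends.
-/
theorem wordFun_of_isRightDescent (hn : 1 ≤ n) {f : Fin (n + 1) → A} (hf : BraidRel f) {w : W n}
    {i : Fin (n + 1)} (hi : (cs n).IsRightDescent w i) :
    wordFun f w = wordFun f (w * (cs n).simple i) * f i := by
  induction hl : (cs n).length w using Nat.strong_induction_on generalizing w i with
  | _ l ih =>
  subst hl
  have hw : w ≠ 1 := by rintro rfl; exact (cs n).not_isRightDescent_one i hi
  obtain ⟨j, hj, e⟩ : ∃ j, (cs n).IsRightDescent w j ∧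
      wordFun f w = wordFun f (w * (cs n).simple j) * f j :=
    ⟨_, ((cs n).exists_rightDescent_of_ne_one hw).choose_spec, by rw [wordFun, dif_neg hw]⟩
  by_cases hij : i = j
  · rwa [hij]
  by_cases hn1 : n = 1
  · exact absurd hj (not_isRightDescent_both hn1 hij hi)
  rw [e]
  by_cases h : j = i + 1 ∨ i = j + 1
  · obtain ⟨a1, a2⟩ := isRightDescent_mul_of_adj (by omega) h hi hj
    obtain ⟨b1, b2⟩ := isRightDescent_mul_of_adj (by omega) h.symm hj hi
    have a0 : (cs n).length _ < _ := hi
    have b0 : (cs n).length _ < _ := hj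
    have a1' : (cs n).length _ < _ := a1
    have b1' : (cs n).length _ < _ := b1
    rw [ih _ a0 a1 rfl, ih _ b0 b1 rfl, ih _ (by omega) a2 rfl, ih _ (by omega) b2 rfl]
    have := (hf hn1 i j hij).1 h
    have e1 := simple_braid h hn1
    simp only [mul_assoc] at this e1 ⊢
    rw [this, e1]
  · push Not at h
    rw [ih _ hj (isRightDescent_mul_of_far hn (Ne.symm hij) h.2 h.1 hi) rfl,
      ih _ hi (isRightDescent_mul_of_far hn hij h.1 h.2 hj) rfl, mul_assoc, mul_assoc,
      (hf hn1 i j hij).2 h.1 h.2, mul_assoc, mul_assoc, simple_comm h.1 h.2 hn1]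

theorem wordFun_mul_simple (hn : 1 ≤ n) {f : Fin (n + 1) → A} (hf : BraidRel f) {w : W n}
    {i : Fin (n + 1)} (hi : ¬ (cs n).IsRightDescent w i) :
    wordFun f (w * (cs n).simple i) = wordFun f w * f i := by
  have h : (cs n).IsRightDescent (w * (cs n).simple i) i := by
    rwa [(cs n).isRightDescent_iff_not_isRightDescent_mul,
      CoxeterSystem.simple_mul_simple_cancel_right]
  rw [wordFun_of_isRightDescent hn hf h, CoxeterSystem.simple_mul_simple_cancel_right]

end Word

open HeckeAlgebra

variable {K : Type*} [CommRing K] (q : K) {A : Type*} [Ring A] [Algebra K A]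

/-- The linear map `g_w ↦ wordFun f w` turns right multiplication by `g_s` into multiplication by
`f`: by compatibility with reduced words when the length grows, by the quadratic relation when it
drops. Multiplicativity follows. -/
theorem exists_lift (hn : 1 ≤ n) {f : Fin (n + 1) → A} (hf : BraidRel f)
    (hq : ∀ i, f i * f i = q • (1 : A) + (q - 1) • f i) :
    ∃ φ : HeckeAlgebra (cs n) q →ₐ[K] A, ∀ i, φ (g (cs n) q ((cs n).simple i)) = f i := by
  let Φ : HeckeAlgebra (cs n) q →ₗ[K] A := (g (cs n) q).constr K (wordFun f)
  have hΦ : ∀ w, Φ (g (cs n) q w) = wordFun f w := fun w => (g (cs n) q).constr_basis K _ w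
  have h1 : Φ 1 = 1 := by rw [← g_one, hΦ, wordFun_one]
  have hmul : ∀ x i, Φ (x * g (cs n) q ((cs n).simple i)) = Φ x * f i := by
    intro x i
    induction x using g_induction with
    | zero => simp
    | add y z hy hz => rw [add_mul, map_add, map_add, add_mul, hy, hz]
    | smul a y hy => rw [smul_mul_assoc, map_smul, map_smul, hy, smul_mul_assoc]
    | basis w =>
      by_cases h : (cs n).IsRightDescent w i
      · rw [g_mul_g_simple_of_isRightDescent _ _ h, map_add, map_smul, map_smul, hΦ, hΦ,
          wordFun_of_isRightDescent hn hf h, mul_assoc, hq, mul_add, mul_smul_comm, mul_smul_comm,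
          mul_one]
      · rw [g_mul_g_simple_of_not_isRightDescent _ _ h, hΦ, hΦ, wordFun_mul_simple hn hf h]
  refine ⟨AlgHom.ofLinearMap Φ h1 (map_mul_of_map_mul_simple _ _ Φ f h1 hmul), fun i => ?_⟩
  have := hmul 1 i
  rwa [h1, one_mul, one_mul] at this

/-- The generators `g_s` satisfy the braid relations. -/
theorem braidRel_g (hn : 1 ≤ n) : BraidRel fun i => g (cs n) q ((cs n).simple i) := by
  intro hn1 i j hij
  -- The words `s_i s_j` and, for adjacent indices, `s_i s_j s_i` are reduced, as the action on ℤ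
  -- shows. The products of generators are then basis elements, and the relations come from the
  -- group.
  have h2 : ∀ i j : Fin (n + 1), i ≠ j → g (cs n) q ((cs n).simple i) *
      g (cs n) q ((cs n).simple j) = g (cs n) q ((cs n).simple i * (cs n).simple j) := by
    intro i j hij
    apply g_mul_g_simple_of_not_isRightDescent
    rw [CoxeterSystem.IsRightDescent, (cs n).length_simple, Nat.lt_one_iff,
      (cs n).length_eq_zero_iff, mul_eq_one_iff_eq_inv, CoxeterSystem.inv_simple]
    intro h
    have h3 := congrArg (fun w => rep hn w i.val) h
    simp only [rep_simple] at h3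
    rw [step_of_eq (res_val i), step, res_val, if_neg hij] at h3
    split_ifs at h3 <;> omega
  constructor
  · intro h
    have h3 : ∀ i j : Fin (n + 1), i ≠ j → (j = i + 1 ∨ i = j + 1) →
        g (cs n) q ((cs n).simple i) * g (cs n) q ((cs n).simple j) *
          g (cs n) q ((cs n).simple i) =
        g (cs n) q ((cs n).simple i * (cs n).simple j * (cs n).simple i) := by
      intro i j hij h
      rw [h2 i j hij]
      apply g_mul_g_simple_of_not_isRightDescent
      rcases h with h | h
      · obtain ⟨k1, k2, k3, k4, k5, k6⟩ := step_values (by omega) h (res_val i)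
        rw [not_isRightDescent_iff_rep_lt hn (res_val i), rep_mul_simple, rep_mul_simple, k4, k5,
          rep_simple, rep_simple, k1, k3]
        omega
      · obtain ⟨k1, k2, k3, k4, k5, k6⟩ := step_values (by omega) h (res_val j)
        rw [not_isRightDescent_iff_rep_lt hn (x := j.val + 1) (by simp [h]), rep_mul_simple,
          rep_mul_simple, k2, k3, rep_simple, rep_simple, k4, k6]
        omega
    dsimp only
    rw [h3 i j hij h, h3 j i hij.symm h.symm, simple_braid h hn1]
  · intro a b
    dsimp only
    rw [h2 i j hij, h2 j i hij.symm, simple_comm a b hn1]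

end AffineA

/-! ### Existence of the morphism -/

theorem braid_conj_of_comm {G : Type*} [Group G] {x p l : G} (h1 : x * p = p * x)
    (h2 : x * l * x = l * x * l) :
    x * (p * l * p⁻¹) * x = p * l * p⁻¹ * x * (p * l * p⁻¹) := by
  have h3 : x = p * x * p⁻¹ := by rw [← h1, mul_inv_cancel_right]
  calc x * (p * l * p⁻¹) * x = p * x * p⁻¹ * (p * l * p⁻¹) * (p * x * p⁻¹) := by rw [← h3]
    _ = p * (x * l * x) * p⁻¹ := by group
    _ = p * l * p⁻¹ * (p * x * p⁻¹) * (p * l * p⁻¹) := by rw [h2]; group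
    _ = _ := by rw [← h3]

theorem conj_eq_of_braid {G : Type*} [Group G] {p l : G} (h : p * l * p = l * p * l) :
    p * l * p⁻¹ = l⁻¹ * p * l⁻¹⁻¹ := by
  rw [inv_inv, mul_inv_eq_iff_eq_mul, mul_assoc, mul_assoc, eq_inv_mul_iff_mul_eq, ← mul_assoc,
    ← mul_assoc, h]

namespace AffineA

open HeckeAlgebra

variable {n : ℕ} {K : Type*} [CommRing K] (q : Kˣ)

theorem braidRel_gUnit (hn : 1 ≤ n) : BraidRel fun i => gUnit (cs n) q i := by
  intro hn1 i j hij
  obtain ⟨h1, h2⟩ := braidRel_g (q : K) hn hn1 i j hij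
  exact ⟨fun h => Units.ext (h1 h), fun h h3 => Units.ext (h2 h h3)⟩

/-- The images of the generators of `HÃ_n(q)` in `HÃ_{n+1}(q)`. -/
noncomputable def genImage (n : ℕ) : Fin (n + 1) → (H q (n + 1))ˣ :=
  Fin.lastCases (gσ q (n + 1) (Fin.last n) * gA q (n + 1) * (gσ q (n + 1) (Fin.last n))⁻¹)
    (fun i => gσ q (n + 1) i.castSucc)

theorem genImage_castSucc (i : Fin n) : genImage q n i.castSucc = gσ q (n + 1) i.castSucc := by
  rw [genImage, Fin.lastCases_castSucc]

theorem genImage_last : genImage q n (Fin.last n) =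
    gσ q (n + 1) (Fin.last n) * gA q (n + 1) * (gσ q (n + 1) (Fin.last n))⁻¹ := by
  rw [genImage, Fin.lastCases_last]

/-- Put `p = g_{σ_{n+1}}` and `l = g_{a_{n+2}}`. The new generator `p l p⁻¹` is also `l⁻¹ p l`. For
`n ≥ 2`, `g_{σ_1}` commutes with `p` and braids with `l`, so the first form serves; `g_{σ_n}`
commutes with `l` and braids with `p`, so the second does. The remaining `g_{σ_i}` commute with
both. -/
theorem braidRel_genImage (n : ℕ) : BraidRel (genImage q n) := by
  intro hn1 i j hij
  have hB : ∀ i j : Fin (n + 2), i ≠ j → _ :=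
    braidRel_gUnit (n := n + 1) q (by omega) (by have := i.pos; omega)
  have key : ∀ i : Fin n,
      ((i.castSucc = Fin.last n + 1 ∨ Fin.last n = i.castSucc + 1) →
        genImage q n i.castSucc * genImage q n (Fin.last n) * genImage q n i.castSucc =
        genImage q n (Fin.last n) * genImage q n i.castSucc * genImage q n (Fin.last n)) ∧
      (i.castSucc ≠ Fin.last n + 1 → Fin.last n ≠ i.castSucc + 1 →
        genImage q n i.castSucc * genImage q n (Fin.last n) =
        genImage q n (Fin.last n) * genImage q n i.castSucc) := by
    intro i
    have hi := i.2
    have hn2 : 2 ≤ n := by omega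
    obtain ⟨x, hx⟩ : ∃ x, x = gUnit (cs (n + 1)) q i.castSucc.castSucc := ⟨_, rfl⟩
    obtain ⟨p, hp⟩ : ∃ p, p = gUnit (cs (n + 1)) q (Fin.last n).castSucc := ⟨_, rfl⟩
    obtain ⟨l, hl⟩ : ∃ l, l = gUnit (cs (n + 1)) q (Fin.last (n + 1)) := ⟨_, rfl⟩
    have e1 : genImage q n i.castSucc = x := by rw [genImage_castSucc, hx]; rfl
    have e2 : genImage q n (Fin.last n) = p * l * p⁻¹ := by rw [genImage_last, hp, hl]; rfl
    rw [e1, e2]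
    have hxp := hB i.castSucc.castSucc (Fin.last n).castSucc (by simp [Fin.ext_iff]; omega)
    have hxl := hB i.castSucc.castSucc (Fin.last (n + 1)) (by simp [Fin.ext_iff]; omega)
    have hpl := (hB (Fin.last n).castSucc (Fin.last (n + 1)) (by simp [Fin.ext_iff])).1
      (Or.inl (by rw [Fin.coeSucc_eq_succ, Fin.succ_last]))
    simp only [← hx, ← hp, ← hl, Fin.coeSucc_eq_succ, Fin.last_add_one, Fin.ext_iff, Ne,
      Fin.val_succ, Fin.val_castSucc, Fin.val_last, Fin.val_zero] at hxp hxl hpl ⊢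
    constructor
    · rintro (h | h)
      · exact braid_conj_of_comm (hxp.2 (by omega) (by omega)) (hxl.1 (by omega))
      · rw [conj_eq_of_braid hpl]
        refine braid_conj_of_comm ?_ (hxp.1 (by omega))
        exact ((show Commute x l from hxl.2 (by omega) (by omega)).inv_right).eq
    · intro h h'
      have c1 : Commute x p := hxp.2 (by omega) (by omega)
      have c2 : Commute x l := hxl.2 (by omega) (by omega)
      exact ((c1.mul_right c2).mul_right c1.inv_right).eq
  induction i using Fin.lastCases with
  | last =>
    induction j using Fin.lastCases with
    | last => exact absurd rfl hij
    | cast j => exact ⟨fun h => ((key j).1 h).symm, fun h h' => ((key j).2 h h').symm⟩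
  | cast i =>
    induction j using Fin.lastCases with
    | last => exact ⟨fun h => (key i).1 h.symm, fun h h' => (key i).2 h' h⟩
    | cast j =>
      have hxy := hB i.castSucc.castSucc j.castSucc.castSucc (by simpa [Fin.ext_iff] using hij)
      rw [genImage_castSucc, genImage_castSucc]
      simp only [Fin.coeSucc_eq_succ, Fin.ext_iff, Ne, Fin.val_succ, Fin.val_castSucc] at hxy ⊢
      exact hxy

theorem genImage_mul_self (n : ℕ) (i : Fin (n + 1)) :
    (genImage q n i : H q (n + 1)) * genImage q n i =
      (q : K) • (1 : H q (n + 1)) + ((q : K) - 1) • (genImage q n i : H q (n + 1)) := by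
  have hs : ∀ j, (gUnit (cs (n + 1)) q j : H q (n + 1)) * gUnit (cs (n + 1)) q j = _ :=
    fun j => g_simple_mul_self (cs (n + 1)) (q : K) j
  induction i using Fin.lastCases with
  | cast i => rw [genImage_castSucc]; exact hs _
  | last =>
    rw [genImage_last]
    obtain ⟨p, hp⟩ : ∃ p, p = gσ q (n + 1) (Fin.last n) := ⟨_, rfl⟩
    obtain ⟨l, hl⟩ : ∃ l, l = gA q (n + 1) := ⟨_, rfl⟩
    have h : (l : H q (n + 1)) * l = (q : K) • (1 : H q (n + 1)) + ((q : K) - 1) • l := by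
      rw [hl]; exact hs _
    rw [← hp, ← hl, ← Units.val_mul]
    have e : p * l * p⁻¹ * (p * l * p⁻¹) = p * (l * l) * p⁻¹ := by group
    rw [e]
    push_cast
    rw [h, mul_add, add_mul, mul_smul_comm, mul_smul_comm, smul_mul_assoc, smul_mul_assoc, mul_one,
      Units.mul_inv]

theorem exists_isHR (hn : 1 ≤ n) : ∃ φ : H q n →ₐ[K] H q (n + 1), IsHR q n φ := by
  have hb : BraidRel fun i => (genImage q n i : H q (n + 1)) := by
    intro hn1 i j hij
    obtain ⟨h1, h2⟩ := braidRel_genImage q n hn1 i j hij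
    refine ⟨fun h => ?_, fun h h' => ?_⟩
    · exact congrArg Units.val (h1 h)
    · exact congrArg Units.val (h2 h h')
  obtain ⟨φ, hφ⟩ := exists_lift (q : K) hn hb (genImage_mul_self q n)
  refine ⟨φ, fun i => ?_, ?_⟩
  · exact (hφ i.castSucc).trans (congrArg Units.val (genImage_castSucc q i))
  · exact (hφ (Fin.last n)).trans (congrArg Units.val (genImage_last q))

theorem isHR_apply {φ : H q n →ₐ[K] H q (n + 1)} (h : IsHR q n φ) (i : Fin (n + 1)) :
    φ (g (cs n) (q : K) ((cs n).simple i)) = genImage q n i := by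
  induction i using Fin.lastCases with
  | cast i => rw [genImage_castSucc]; exact h.1 i
  | last => rw [genImage_last]; exact h.2

end AffineA

/-! ### Adding a strand to an affine permutation -/

namespace AffineA

variable {n : ℕ}

theorem res_natCast_add_mul {r : ℕ} (hr : r < n + 1) (m : ℤ) :
    res n (r + m * (n + 1)) = ⟨r, hr⟩ := by
  rw [res_add_mul]; exact res_val ⟨r, hr⟩

theorem step_castSucc (i : Fin n) {r : ℕ} (hr : r < n + 1) (m : ℤ) :
    step i.castSucc (r + m * (n + 1)) =
      (if r = i then (r : ℤ) + 1 else if r = i + 1 then (r : ℤ) - 1 else r) + m * (n + 1) := by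
  rw [step, res_natCast_add_mul hr, Fin.coeSucc_eq_succ]
  simp only [Fin.ext_iff, Fin.val_castSucc, Fin.val_succ]
  split_ifs <;> ring

theorem step_last {r : ℕ} (hr : r < n + 1) (m : ℤ) :
    step (Fin.last n) (r + m * (n + 1)) =
      if r = n then (m + 1) * (n + 1) else
        if r = 0 then (n : ℤ) + (m - 1) * (n + 1) else r + m * (n + 1) := by
  rw [step, res_natCast_add_mul hr, Fin.last_add_one]
  simp only [Fin.ext_iff, Fin.val_last, Fin.val_zero]
  split_ifs with h1 h2
  · rw [h1]; ring
  · rw [h2]; push_cast; ring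
  · rfl

/-- The increasing enumeration of the integers not congruent to `n + 1` modulo `n + 2`. -/
def skip (n : ℕ) (x : ℤ) : ℤ := x + x / (n + 1)

/-- The integers congruent to `n + 1` modulo `n + 2`. -/
def special (n : ℕ) (l : ℤ) : ℤ := n + 1 + l * (n + 2)

theorem skip_add_mul {r : ℤ} (h0 : 0 ≤ r) (hr : r < n + 1) (m : ℤ) :
    skip n (r + m * (n + 1)) = r + m * (n + 2) := by
  have h : ((n : ℤ) + 1) ≠ 0 := by omega
  rw [skip, Int.add_mul_ediv_right _ _ h, Int.ediv_eq_zero_of_lt h0 hr]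
  ring

theorem skip_strictMono (n : ℕ) : StrictMono (skip n) := by
  intro x y h
  have := Int.ediv_le_ediv (c := (n : ℤ) + 1) (by omega) h.le
  unfold skip
  omega

theorem exists_coord (n : ℕ) (x : ℤ) : ∃ (r : ℕ) (m : ℤ), r < n + 1 ∧ x = r + m * (n + 1) := by
  have h : (0 : ℤ) < n + 1 := by omega
  refine ⟨(x % (n + 1)).toNat, x / (n + 1), ?_, ?_⟩
  · have := Int.emod_lt_of_pos x h
    have := Int.emod_nonneg x h.ne'
    omega
  · rw [Int.toNat_of_nonneg (Int.emod_nonneg x h.ne'), mul_comm, Int.emod_add_mul_ediv]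

/-- With the next three lemmas on `step`, this describes adding a strand on generators: `σ_i` goes
to `σ_i` and `a_{n+1}` to `σ_{n+1} a_{n+2} σ_{n+1}`, and both images fix the special integers. -/
theorem skip_step_castSucc (i : Fin n) (x : ℤ) :
    skip n (step i.castSucc x) = step i.castSucc.castSucc (skip n x) := by
  obtain ⟨r, m, hr, rfl⟩ := exists_coord n x
  have hi := i.2
  have e := step_castSucc (n := n + 1) i.castSucc (r := r) (by omega) m
  push_cast at e
  rw [show (n : ℤ) + 1 + 1 = n + 2 by ring] at e
  rw [step_castSucc i hr, skip_add_mul (r := r) (by omega) (by omega), skip_add_mul, e]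
  · rfl
  · split_ifs <;> omega
  · split_ifs <;> omega

theorem step_castSucc_special (i : Fin n) (l : ℤ) :
    step i.castSucc.castSucc (special n l) = special n l := by
  have hi := i.2
  have e := step_castSucc (n := n + 1) i.castSucc (r := n + 1) (by omega) l
  push_cast at e
  rw [show (n : ℤ) + 1 + 1 = n + 2 by ring] at e
  rw [special, e, if_neg (by simp; omega), if_neg (by simp; omega)]

section

variable (n)

theorem step_pen {r : ℕ} (hr : r < n + 2) (m : ℤ) :
    step (Fin.last n).castSucc (r + m * (n + 2)) =
      (if r = n then (n : ℤ) + 1 else if r = n + 1 then (n : ℤ) else r) + m * (n + 2) := by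
  have e := step_castSucc (n := n + 1) (Fin.last n) hr m
  push_cast at e
  rw [show (n : ℤ) + 1 + 1 = n + 2 by ring] at e
  rw [e]
  split_ifs with h1 h2
  · rw [h1]
  · rw [h2]; push_cast; ring
  · rfl

theorem step_last_succ {r : ℕ} (hr : r < n + 2) (m : ℤ) :
    step (Fin.last (n + 1)) (r + m * (n + 2)) =
      if r = n + 1 then (m + 1) * (n + 2) else
        if r = 0 then (n : ℤ) + 1 + (m - 1) * (n + 2) else r + m * (n + 2) := by
  have e := step_last (n := n + 1) hr m
  push_cast at e
  rwa [show (n : ℤ) + 1 + 1 = n + 2 by ring] at e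

end

theorem skip_step_last (hn : 1 ≤ n) (x : ℤ) :
    skip n (step (Fin.last n) x) = step (Fin.last n).castSucc
      (step (Fin.last (n + 1)) (step (Fin.last n).castSucc (skip n x))) := by
  obtain ⟨r, m, hr, rfl⟩ := exists_coord n x
  rw [step_last hr, skip_add_mul (by omega) (by omega), step_pen n (by omega)]
  by_cases h : r = n
  · have e1 := step_last_succ n (r := n + 1) (by omega) m
    have e2 := step_pen n (r := 0) (by omega) (m + 1)
    have e3 := skip_add_mul (n := n) (r := 0) le_rfl (by omega) (m + 1)
    rw [if_pos rfl] at e1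
    rw [if_neg (by omega), if_neg (by omega)] at e2
    push_cast at e1 e2
    rw [zero_add] at e2 e3
    rw [if_pos h, if_pos h, e1, e2, e3, zero_add]
  have h' : r ≠ n + 1 := by omega
  rw [if_neg h, if_neg h, if_neg h', step_last_succ n (by omega), if_neg h']
  by_cases h0 : r = 0
  · have e2 := step_pen n (r := n + 1) (by omega) (m - 1)
    rw [if_neg (by omega), if_pos rfl] at e2
    push_cast at e2
    rw [if_pos h0, if_pos h0, e2, skip_add_mul (by omega) (by omega)]
  · rw [if_neg h0, if_neg h0, step_pen n (by omega), if_neg h, if_neg h',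
      skip_add_mul (by omega) (by omega)]

theorem step_last_special (hn : 1 ≤ n) (l : ℤ) :
    step (Fin.last n).castSucc (step (Fin.last (n + 1)) (step (Fin.last n).castSucc
      (special n l))) = special n l := by
  have e1 := step_pen n (r := n + 1) (by omega) l
  have e2 := step_last_succ n (r := n) (by omega) l
  have e3 := step_pen n (r := n) (by omega) l
  push_cast at e1 e2 e3
  rw [special, e1, if_neg (by omega), if_pos rfl, e2, if_neg (by omega), if_neg (by omega), e3,
    if_pos rfl]

/-- The witness is `s_{m-1} ⋯ s_0 s_{n+1}`: the special strand crosses into the next period and then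
passes the strands `0, …, m - 1` one at a time, lowering each by one place. -/
theorem exists_partial_shift (hn : 1 ≤ n) (m : ℕ) (hm : m ≤ n) : ∃ v : W (n + 1), ∀ l : ℤ,
    rep (by omega) v (special n l) = m + (l + 1) * (n + 2) ∧
    rep (by omega) v (l * (n + 2)) = special n (l - 1) ∧
    ∀ r : ℕ, 1 ≤ r → r ≤ n →
      rep (by omega) v (r + l * (n + 2)) = (if r ≤ m then (r : ℤ) - 1 else r) + l * (n + 2) := by
  induction m with
  | zero =>
    refine ⟨(cs (n + 1)).simple (Fin.last (n + 1)), fun l => ?_⟩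
    simp only [rep_simple]
    refine ⟨?_, ?_, fun r h1 h2 => ?_⟩
    · have := step_last_succ n (r := n + 1) (by omega) l
      push_cast at this
      rw [special, this, if_pos rfl]; simp
    · have := step_last_succ n (r := 0) (by omega) l
      rw [if_neg (by omega), if_pos rfl, Nat.cast_zero, zero_add] at this
      rw [this, special]
    · rw [step_last_succ n (by omega), if_neg (by omega), if_neg (by omega), if_neg (by omega)]
  | succ m ih =>
    obtain ⟨v, hv⟩ := ih (by omega)
    have key : ∀ (r : ℕ), r < n + 2 → ∀ l : ℤ,
        step (⟨m, by omega⟩ : Fin (n + 1)).castSucc (r + l * (n + 2)) =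
        (if r = m then (r : ℤ) + 1 else if r = m + 1 then (r : ℤ) - 1 else r) + l * (n + 2) := by
      intro r hr l
      have e := step_castSucc (n := n + 1) ⟨m, by omega⟩ hr l
      push_cast at e
      rwa [show (n : ℤ) + 1 + 1 = n + 2 by ring] at e
    refine ⟨(cs (n + 1)).simple (⟨m, by omega⟩ : Fin (n + 1)).castSucc * v, fun l => ?_⟩
    obtain ⟨h1, h2, h3⟩ := hv l
    simp only [map_mul, Equiv.Perm.mul_apply, rep_simple]
    refine ⟨?_, ?_, fun r hr1 hr2 => ?_⟩
    · rw [h1, key m (by omega), if_pos rfl]; push_cast; ring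
    · rw [h2, special]
      have := key (n + 1) (by omega) (l - 1)
      push_cast at this
      rw [this, if_neg (by omega), if_neg (by omega)]
    · rw [h3 r hr1 hr2]
      by_cases hrm : r ≤ m
      · obtain ⟨s, rfl⟩ := Nat.exists_eq_add_of_le' hr1
        have := key s (by omega) l
        rw [if_pos hrm, if_pos (by omega)]
        push_cast
        rw [add_sub_cancel_right, this, if_neg (by omega), if_neg (by omega)]
      · rw [if_neg hrm, key r (by omega), if_neg (by omega)]
        split_ifs <;> first | rfl | omega

/-- An element that moves the special strands to the right past all other strands. -/
theorem exists_shift (hn : 1 ≤ n) : ∃ c : W (n + 1),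
    (∀ x, rep (by omega) c (skip n x) = skip n (x - 1)) ∧
    ∀ l, rep (by omega) c (special n l) = special n (l + 1) := by
  obtain ⟨v, hv⟩ := exists_partial_shift hn n le_rfl
  -- One last crossing, with the strand at `n`, brings the special strand to the next special
  -- position; `c` is a product of all the generators, once each.
  refine ⟨(cs (n + 1)).simple (Fin.last n).castSucc * v, fun x => ?_, fun l => ?_⟩ <;>
    simp only [map_mul, Equiv.Perm.mul_apply, rep_simple]
  · obtain ⟨r, m, hr, rfl⟩ := exists_coord n x
    rw [skip_add_mul (by omega) (by omega)]
    obtain ⟨-, h2, h3⟩ := hv m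
    rcases Nat.eq_zero_or_pos r with rfl | hr0
    · have e1 := step_pen n (r := n + 1) (by omega) (m - 1)
      have e2 := skip_add_mul (n := n) (r := n) (by omega) (by omega) (m - 1)
      push_cast at e1 ⊢
      rw [zero_add, h2, special, e1, if_neg (by omega), if_pos rfl, ← e2]
      congr 1
      ring
    · rw [h3 r hr0 (by omega), if_pos (by omega)]
      obtain ⟨s, rfl⟩ := Nat.exists_eq_add_of_le' hr0
      push_cast
      rw [add_sub_cancel_right, step_pen n (by omega), if_neg (by omega), if_neg (by omega),
        ← skip_add_mul (by omega) (by omega)]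
      congr 1
      ring
  · rw [(hv l).1, step_pen n (by omega), if_pos rfl, special]

theorem rep_shift_pow (hn : 1 ≤ n + 1) {c : W (n + 1)}
    (h1 : ∀ x, rep hn c (skip n x) = skip n (x - 1))
    (h2 : ∀ l, rep hn c (special n l) = special n (l + 1)) (k : ℕ) :
    (∀ x, rep hn (c ^ k) (skip n x) = skip n (x - k)) ∧
    ∀ l, rep hn (c ^ k) (special n l) = special n (l + k) := by
  induction k with
  | zero => simp
  | succ k ih =>
    refine ⟨fun x => ?_, fun l => ?_⟩ <;> rw [pow_succ', map_mul, Equiv.Perm.mul_apply]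
    · rw [ih.1, h1]; push_cast; congr 1; ring
    · rw [ih.2, h2]; push_cast; congr 1; ring

end AffineA

/-! ### Injectivity -/

namespace AffineA

open HeckeAlgebra

variable {n : ℕ} {K : Type*} [CommRing K] (q : Kˣ)

/-- This makes "`k` large" explicit: `skip n (t - k) ≤ skip n t ≤ k < special n k`. -/
theorem skip_sub_lt_special (n : ℕ) {t : ℤ} {k : ℕ} (h : (skip n t).natAbs ≤ k) :
    skip n (t - k) < special n k := by
  have h1 : skip n (t - k) ≤ skip n t := (skip_strictMono n).monotone (by omega)
  have h2 : (0 : ℤ) ≤ k * (n + 1) := by positivity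
  have h3 : special n k = n + 1 + (k + k * (n + 1)) := by rw [special]; ring
  omega

/-- The image of `e_w` is `g_{c^k}⁻¹ g_{c^k v}` for large `k`, where `v` is the affine permutation
obtained from `w` by adding a strand. -/
theorem exists_image {φ : H q n →ₐ[K] H q (n + 1)} (hφ : IsHR q n φ) (hn : 1 ≤ n)
    (hn' : 1 ≤ n + 1) {c : W (n + 1)} (hc1 : ∀ x, rep hn' c (skip n x) = skip n (x - 1))
    (hc2 : ∀ l, rep hn' c (special n l) = special n (l + 1)) (w : W n) :
    ∃ v : W (n + 1), (∀ x, rep hn' v (skip n x) = skip n (rep hn w x)) ∧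
      (∀ l, rep hn' v (special n l) = special n l) ∧
      ∃ k₀ : ℕ, ∀ k ≥ k₀, g (cs (n + 1)) (q : K) (c ^ k) * φ (g (cs n) (q : K) w) =
        g (cs (n + 1)) (q : K) (c ^ k * v) := by
  induction hl : (cs n).length w using Nat.strong_induction_on generalizing w with
  | _ l ih =>
  subst hl
  by_cases hw : w = 1
  · refine ⟨1, by simp [hw], by simp, 0, fun k _ => ?_⟩
    rw [hw, g_one, map_one φ, mul_one, mul_one]
  obtain ⟨i, hi⟩ := (cs n).exists_rightDescent_of_ne_one hw
  obtain ⟨u, rfl⟩ : ∃ u, w = u * (cs n).simple i :=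
    ⟨w * (cs n).simple i, ((cs n).simple_mul_simple_cancel_right i).symm⟩
  have hu : ¬ (cs n).IsRightDescent u i := by
    have := (cs n).isRightDescent_iff_not_isRightDescent_mul.1 hi
    rwa [CoxeterSystem.simple_mul_simple_cancel_right] at this
  have lu := (cs n).not_isRightDescent_iff.1 hu
  obtain ⟨v, hv1, hv2, k₀, hk⟩ := ih _ (by omega) u rfl
  have hy1 : ∀ (k : ℕ) x, rep hn' (c ^ k * v) (skip n x) = skip n (rep hn u x - k) := by
    intro k x
    rw [map_mul, Equiv.Perm.mul_apply, hv1, (rep_shift_pow hn' hc1 hc2 k).1]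
  have hy2 : ∀ (k : ℕ) l, rep hn' (c ^ k * v) (special n l) = special n (l + k) := by
    intro k l
    rw [map_mul, Equiv.Perm.mul_apply, hv2, (rep_shift_pow hn' hc1 hc2 k).2]
  have hφu : φ (g (cs n) (q : K) (u * (cs n).simple i)) =
      φ (g (cs n) (q : K) u) * genImage q n i := by
    rw [← g_mul_g_simple_of_not_isRightDescent _ _ hu, map_mul φ, isHR_apply q hφ]
  have hskip : ∀ r : ℤ, 0 ≤ r → r < n + 1 → skip n r = r := by
    intro r h0 hr
    simpa using skip_add_mul (n := n) h0 hr 0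
  rw [hφu]
  induction i using Fin.lastCases with
  | cast i =>
    have hi2 := i.2
    refine ⟨v * (cs (n + 1)).simple i.castSucc.castSucc, fun x => ?_, fun l => ?_, k₀,
      fun k hk' => ?_⟩
    · rw [rep_mul_simple, rep_mul_simple, ← skip_step_castSucc, hv1]
    · rw [rep_mul_simple, step_castSucc_special, hv2]
    -- Both positions are ordinary, and `skip` and the common shift by `k` preserve order, so `σ_i`
    -- lengthens `c^k v` because it lengthens `u`. No new bound on `k` is needed.
    · have hlt := rep_lt_of_not_isRightDescent hn hu (res_val i.castSucc)
      have hd : ¬ (cs (n + 1)).IsRightDescent (c ^ k * v) i.castSucc.castSucc := by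
        rw [not_isRightDescent_iff_rep_lt hn' (res_val i.castSucc.castSucc)]
        simp only [Fin.val_castSucc] at hlt ⊢
        have y0 := hy1 k i
        have y1 := hy1 k (i + 1)
        rw [hskip _ (by omega) (by omega)] at y0 y1
        rw [y0, y1]
        exact skip_strictMono n (by omega)
      rw [← mul_assoc, hk k hk', genImage_castSucc]
      refine (g_mul_g_simple_of_not_isRightDescent _ _ hd).trans ?_
      rw [mul_assoc]
  | last =>
    have hlt := rep_lt_of_not_isRightDescent hn hu (res_val (Fin.last n))
    rw [Fin.val_last] at hlt
    -- The bound on `k` is raised so that the special value at `n + 1` exceeds the values of `c^k v`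
    -- at its neighbours `n` and `n + 2`.
    refine ⟨v * (cs (n + 1)).simple (Fin.last n).castSucc * (cs (n + 1)).simple (Fin.last (n + 1)) *
      (cs (n + 1)).simple (Fin.last n).castSucc, fun x => ?_, fun l => ?_,
      k₀ + (skip n (rep hn u n)).natAbs + (skip n (rep hn u (n + 1))).natAbs, fun k hk' => ?_⟩
    · simp only [rep_mul_simple]
      rw [← skip_step_last hn, hv1]
    · simp only [rep_mul_simple]
      rw [step_last_special hn, hv2]
    · have hp : res (n + 1) (n : ℤ) = (Fin.last n).castSucc := res_val (Fin.last n).castSucc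
      have hl : res (n + 1) ((n : ℤ) + 1) = Fin.last (n + 1) := by
        have := res_val (Fin.last (n + 1))
        rw [Fin.val_last] at this
        exact_mod_cast this
      obtain ⟨k1, k2, k3, k4, k5, k6⟩ := step_values (n := n + 1) (by omega)
        (i := (Fin.last n).castSucc) (j := Fin.last (n + 1))
        (by rw [Fin.coeSucc_eq_succ, Fin.succ_last]) hp
      have s0 : skip n n = n := hskip n (by omega) (by omega)
      have s1 : special n 0 = n + 1 := by simp [special]
      have s2 : skip n (n + 1) = n + 1 + 1 := by
        have := skip_add_mul (n := n) (r := 0) le_rfl (by omega) 1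
        rw [zero_add, one_mul] at this
        rw [this]; ring
      have y0 := hy1 k n
      have y1 := hy2 k 0
      have y2 := hy1 k (n + 1)
      rw [s0] at y0
      rw [s1, zero_add] at y1
      rw [s2] at y2
      have b0 : skip n (rep hn u n - k) < special n k := skip_sub_lt_special n (by omega)
      have b1 : skip n (rep hn u (n + 1) - k) < special n k := skip_sub_lt_special n (by omega)
      -- At `n, n + 1, n + 2` the values of `c^k v` are ordinary, special, ordinary, with the
      -- special one largest and the ordinary ones increasing. So `σ_{n+1}` lengthens, then
      -- `a_{n+2}` lengthens, and the last `σ_{n+1}` shortens, which is exactly where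
      -- `g_{σ_{n+1}}⁻¹` acts without correction.
      have d1 : ¬ (cs (n + 1)).IsRightDescent (c ^ k * v) (Fin.last n).castSucc := by
        rw [not_isRightDescent_iff_rep_lt hn' hp, y0, y1]
        exact b0
      have d2 : ¬ (cs (n + 1)).IsRightDescent
          (c ^ k * v * (cs (n + 1)).simple (Fin.last n).castSucc) (Fin.last (n + 1)) := by
        rw [not_isRightDescent_iff_rep_lt hn' hl, rep_mul_simple, rep_mul_simple, k2, k3, y0, y2]
        exact skip_strictMono n (by omega)
      have d3 : (cs (n + 1)).IsRightDescent
          (c ^ k * v * (cs (n + 1)).simple (Fin.last n).castSucc *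
            (cs (n + 1)).simple (Fin.last (n + 1))) (Fin.last n).castSucc := by
        rw [isRightDescent_iff_rep_lt hn' hp]
        simp only [rep_mul_simple, k1, k3, k4, k5, y1, y2]
        exact b1
      rw [← mul_assoc, hk k (by omega), genImage_last, Units.val_mul, Units.val_mul, ← mul_assoc,
        ← mul_assoc, Units.mul_inv_eq_iff_eq_mul]
      change g (cs (n + 1)) (q : K) _ * g (cs (n + 1)) (q : K) _ * g (cs (n + 1)) (q : K) _ =
        g (cs (n + 1)) (q : K) _ * g (cs (n + 1)) (q : K) ((cs (n + 1)).simple _)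
      rw [g_mul_g_simple_of_not_isRightDescent _ _ d1, g_mul_g_simple_of_not_isRightDescent _ _ d2,
        ← g_mul_simple_mul_g_simple _ _ d3]
      simp only [mul_assoc]

theorem injective_of_isHR (hn : 1 ≤ n) {φ : H q n →ₐ[K] H q (n + 1)} (hφ : IsHR q n φ) :
    Function.Injective φ := by
  have hn' : 1 ≤ n + 1 := by omega
  obtain ⟨c, hc1, hc2⟩ := exists_shift hn
  choose v hv1 hv2 k hk using exists_image q hφ hn hn' hc1 hc2
  refine injective_of_leading_term (cs n) (cs (n + 1)) (q : K) (q : K) φ.toLinearMap v ?_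
    fun w => ?_
  -- The extension determines `w`, since it restricts to `w` along the injective map `skip` and the
  -- action is faithful.
  · intro w w' h
    apply rep_injective hn
    ext x
    apply (skip_strictMono n).injective
    rw [← hv1, h, hv1]
  · exact sub_mem_filt_of_g_mul_eq (cs (n + 1)) q (hk w (k w) le_rfl)

end AffineA

/-! ### Existence, uniqueness and injectivity of the tower maps -/

theorem mainTheorem6 {K : Type*} [CommRing K] (q : Kˣ) (n : ℕ) (hn : 1 ≤ n) :
    (∃! φ : AffineA.H q n →ₐ[K] AffineA.H q (n + 1), AffineA.IsHR q n φ) ∧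
      ∀ φ : AffineA.H q n →ₐ[K] AffineA.H q (n + 1),
        AffineA.IsHR q n φ → Function.Injective φ := by
  refine ⟨?_, fun φ hφ => AffineA.injective_of_isHR q hn hφ⟩
  obtain ⟨φ, hφ⟩ := AffineA.exists_isHR q hn
  refine ⟨φ, hφ, fun ψ hψ => HeckeAlgebra.algHom_ext _ _ fun i => ?_⟩
  rw [AffineA.isHR_apply q hψ, AffineA.isHR_apply q hφ]
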